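/- Let $k\ge 1$. A *$k$-tree* is a graph obtained from the complete graph $K_k$ by repeatedly (possibly zero times) adding a new vertex joined exactly to the vertices of some $k$-clique of the current graph. A *sub-$k$-tree* of a $k$-tree $T$ is a subgraph of $T$ that is itself a $k$-tree, and $\mu(T)$ denotes the average number of vertices of a sub-$k$-tree of $T$ (the average is taken over all sub-$k$-trees of $T$). The *degree* of a $k$-clique $C$ of $T$ is the number of $(k+1)$-cliques of $T$ that contain $C$. The *$k$-star* of order $n\ge k$ consists of a $K_k$ together with $n-k$ pairwise non-adjacent vertices, each joined to all vertices of the $K_k$. For $t\ge 0$, the *$k$-caterpillar* $P_{k,t}$, of order $2t+k+3$, has stem vertices $v_0,\dots,v_{k+t-1}$, with $v_i,v_j$ adjacent iff $0<|i-j|\le k$; for each $a=0,\dots,t$ it has a further vertex joined exactly to $v_a,\dots,v_{a+k-1}$, and it has two more vertices, one joined exactly to $v_0,\dots,v_{k-1}$ and one joined exactly to $v_t,\dots,v_{t+k-1}$. **Theorem.** Let $k\ge1$ be fixed. 1. (Lower bound.) There is a function $\varepsilon:\mathbb N\to\mathbb R$ (which may depend on $k$) with $\varepsilon(n)\to0$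 as $n\to\infty$ such that every $k$-tree $T$ of order $n$ without $k$-cliques of degree $2$ satisfies $$\frac{n+k}{2}-\varepsilon(n)<\mu(T).$$ 2. (Upper bound.) Every $k$-tree $T$ of order $n\ge k+2$ without $k$-cliques of degree $2$ satisfies $$\mu(T)<\frac{3n+k-3}{4}.$$ 3. (Sharpness of the lower bound.) For $n\ge k+3$ the $k$-star $S_{k,n}$ of order $n$ is a $k$-tree without $k$-cliques of degree $2$, and $\frac{n+k}{2}-\mu(S_{k,n})\to0$ as $n\to\infty$. 4. (Sharpness of the upper bound.) Every $k$-caterpillar $P_{k,t}$ is a $k$-tree without $k$-cliques of degree $2$, and with $n=2t+k+3$ its order, $\frac{3n+k-3}{4}-\mu(P_{k,t})\to\frac73$ as $t\to\infty$. 5. (Extremal graph.) There is $n_0$ (which may depend on $k$) such that for every $n\ge n_0$ the $k$-star of order $n$ is a $k$-tree without $k$-cliques of degree $2$, and every $k$-tree $T$ of order $n$ without $k$-cliques of degree $2$ satisfies $\mu(T)\ge\mu(S_{k,n})$, with equality if and only if $T$ is isomorphic to $S_{k,n}$. Moreover, for all sufficiently large $k$, $\frac{3n}{4}$ is not an upper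 bound: for every $n_0$ there is a $k$-tree $T$ of some order $n\ge n_0$ without $k$-cliques of degree $2$ and with $\mu(T)>\frac{3n}{4}$. -/

import Mathlib

open Filter Topology

universe u

/-- `k`-trees: the complete graph `K_k` is a `k`-tree, and so is every graph `G` with a vertex `v`
whose neighbours are exactly the vertices of a `k`-clique and for which `G - v` is a `k`-tree. -/
inductive IsKTree (k : ℕ) : {V : Type u} → SimpleGraph V → Prop
  | complete {V : Type u} (G : SimpleGraph V)
      (h : Nonempty (G ≃g (⊤ : SimpleGraph (Fin k)))) : IsKTree k G
  | join {V : Type u} (G : SimpleGraph V) (v : V) (C : Finset V)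
      (hC : G.IsNClique k C) (hv : ∀ w, G.Adj v w ↔ w ∈ C)
      (h : IsKTree k (G.induce ({v}ᶜ : Set V))) : IsKTree k G

/-- The sub-`k`-trees of `G`: the subgraphs of `G` that are themselves `k`-trees. -/
noncomputable def subKTrees (k : ℕ) {V : Type u} [Finite V] (G : SimpleGraph V) :
    Finset G.Subgraph :=
  (Set.toFinite {H : G.Subgraph | IsKTree k H.coe}).toFinset

/-- The global mean sub-`k`-tree order `μ(G) = R(G) / N(G)`. -/
noncomputable def globalMean (k : ℕ) {V : Type u} [Finite V] (G : SimpleGraph V) : ℝ :=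
  (∑ H ∈ subKTrees k G, (H.verts.ncard : ℝ)) / ((subKTrees k G).card : ℝ)

/-- The degree of a `k`-clique `C`: the number of `(k+1)`-cliques that contain `C`. -/
noncomputable def cliqueDegree (k : ℕ) {V : Type u} (G : SimpleGraph V) (C : Finset V) : ℕ :=
  {B : Finset V | G.IsNClique (k + 1) B ∧ C ⊆ B}.ncard

/-- No `k`-clique of `G` has degree `2`. -/
def NoCliqueOfDegreeTwo (k : ℕ) {V : Type u} (G : SimpleGraph V) : Prop :=
  ∀ C : Finset V, G.IsNClique k C → cliqueDegree k G C ≠ 2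

/-- The `k`-star of order `n` (for `n ≥ k`): a complete graph `K_k`, on the vertices `0, …, k - 1`,
together with `n - k` pairwise non-adjacent vertices, each joined to all vertices of `K_k`. -/
def kStar (k n : ℕ) : SimpleGraph (Fin n) :=
  SimpleGraph.fromRel fun i _ => i.val < k

/-- The relation generating the `k`-caterpillar below (read symmetrically). -/
def kCaterpillarRel (k t : ℕ) :
    Fin (k + t) ⊕ (Fin (t + 1) ⊕ Bool) → Fin (k + t) ⊕ (Fin (t + 1) ⊕ Bool) → Prop
  | .inl i, .inl j => i.val ≤ j.val ∧ j.val ≤ i.val + k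
  | .inr (.inl a), .inl i => a.val ≤ i.val ∧ i.val < a.val + k
  | .inr (.inr false), .inl i => i.val < k
  | .inr (.inr true), .inl i => t ≤ i.val
  | _, .inr _ => False

/-- The `k`-caterpillar with stem vertices `v_0, …, v_{k+t-1}`, any `k + 1` consecutive ones of which
form a clique (`v_i` and `v_j` are adjacent iff `0 < |i - j| ≤ k`); for each of the `t + 1` sets of
`k` consecutive stem vertices it has a `k`-leaf joined to this set, and it has two more `k`-leaves,
one joined to the first `k` and one joined to the last `k` stem vertices.
Its order is `(k + t) + (t + 1) + 2 = 2 t + k + 3`. -/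
def kCaterpillar (k t : ℕ) : SimpleGraph (Fin (k + t) ⊕ (Fin (t + 1) ⊕ Bool)) :=
  SimpleGraph.fromRel (kCaterpillarRel k t)

universe v

set_option linter.unusedSectionVars false

/-! Sub-`k`-trees of a `k`-tree are induced subgraphs, so everything is counted over vertex sets `A`
with `KT k G A`. A `k`-tree of order n grows from each of its sub-`k`-trees (`KT.exists_step`), so
any `k`-clique `c` can serve as a root towards which the other vertices are peeled off, last one
first. When a vertex `v` joined to `C` is peeled off, each sub-`k`-tree through `v` is either a
single new `k`-clique or `insert v B` with `C ⊆ B` (`IsStep.sum_Fam_insert`). The second kind is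
remembered by multiplying a weight on `C` by `1 + ∏ w u`, taken over the new cliques (`absorb`). The
inductions therefore run over general weights, specialised to 1 at the end.

Lower bound and extremality. Put m = n - k. Among the sub-`k`-trees containing `c`, each branch
contributes on average at least half of its vertices. Since no clique has degree 2, a branch with
more than one vertex has a clique carrying at least two further branches, and this yields a surplus
of 1/10 (`Inv.merge`). So the local mean number of vertices outside `c` is at least m/2 + 1/10,
unless every `(k+1)`-clique contains `c`, that is, unless the graph is a star (`exists_inv`). To
pass to the global mean, let `c` lie in the largest number x of sub-`k`-trees. Then x² ≥ 2^m, while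
at most k·m·√x sub-`k`-trees avoid `c` (`card_mul_card_le`, `card_avoid_le`). For large n these
cannot absorb the surplus, so a non-star has mean above k + m/2, whereas the star has mean at most k
+ m/2 (`star_or_half_lt`).

Upper bound. The order of a sub-`k`-tree is k plus its number of `(k+1)`-cliques. The `(k+1)`-clique
at a vertex of degree k lies in fewer than half of all sub-`k`-trees, and excluding degree 2 forces
at least (n - k + 3)/2 such vertices (`le_two_mul_card_leaves`, `sum_card_lt`).

Stars and caterpillars are counted exactly by the recursions `State.leaf` and `State.extend`. The
caterpillar's limiting gap 7/3 is independent of k, which is why 3n/4 fails for k ≥ 13. -/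

namespace SubKTree

/-! ### Vertex sets that induce `k`-trees -/

variable {V : Type*} [DecidableEq V] {k : ℕ} {G : SimpleGraph V}

/-- `v` is a new vertex whose neighbours in `S` are exactly the vertices of the `k`-clique `C`. -/
structure IsStep (k : ℕ) (G : SimpleGraph V) (S : Finset V) (v : V) (C : Finset V) : Prop where
  notMem : v ∉ S
  subset : C ⊆ S
  clique : G.IsNClique k C
  adj : ∀ w ∈ S, G.Adj v w ↔ w ∈ C

/-- The finsets of vertices that induce a `k`-tree. -/
inductive KT (k : ℕ) (G : SimpleGraph V) : Finset V → Prop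
  | base (C : Finset V) (h : G.IsNClique k C) : KT k G C
  | step (S : Finset V) (v : V) (C : Finset V) (hS : KT k G S) (h : IsStep k G S v C) :
      KT k G (insert v S)

theorem KT.card_le {S : Finset V} (h : KT k G S) : k ≤ S.card := by
  induction h with
  | base C h => exact h.card_eq.ge
  | step S v C hS h ih => rw [Finset.card_insert_of_notMem h.notMem]; omega

theorem KT.isNClique_of_card {S : Finset V} (h : KT k G S) (hc : S.card = k) :
    G.IsNClique k S := by
  cases h with
  | base C h => exact h
  | step S v C hS h =>
    rw [Finset.card_insert_of_notMem h.notMem] at hc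
    have := hS.card_le
    omega

theorem IsStep.mono {S A : Finset V} {v : V} {C : Finset V} (h : IsStep k G S v C)
    (hA : A ⊆ S) (hC : C ⊆ A) : IsStep k G A v C :=
  ⟨fun hv => h.notMem (hA hv), hC, h.clique, fun w hw => h.adj w (hA hw)⟩

theorem IsStep.notMem_clique {S : Finset V} {v : V} {C : Finset V} (h : IsStep k G S v C) :
    v ∉ C := fun hv => h.notMem (h.subset hv)

theorem IsStep.isNClique_insert {S : Finset V} {v : V} {C : Finset V} (h : IsStep k G S v C) :
    G.IsNClique (k + 1) (insert v C) :=
  h.clique.insert fun w hw => (h.adj w (h.subset hw)).2 hw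

theorem IsStep.isNClique_new {S : Finset V} {v : V} {C : Finset V} (h : IsStep k G S v C)
    {x : V} (hx : x ∈ C) : G.IsNClique k (insert v (C.erase x)) := by
  have hvC := h.notMem_clique
  refine ⟨h.isNClique_insert.isClique.subset ?_, ?_⟩
  · exact_mod_cast Finset.insert_subset_insert v (Finset.erase_subset x C)
  · rw [Finset.card_insert_of_notMem (fun hv => hvC (Finset.mem_of_mem_erase hv)),
      Finset.card_erase_of_mem hx, h.clique.card_eq]
    have : 0 < C.card := Finset.card_pos.2 ⟨x, hx⟩
    have := h.clique.card_eq
    omega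

/-- A vertex of a `k`-tree whose neighbours lie in a `k`-clique can be removed. -/
theorem KT.remove {A : Finset V} (h : KT k G A) :
    ∀ {x : V} {C : Finset V}, x ∈ A → C.card = k → (∀ w ∈ A, G.Adj x w → w ∈ C) →
      k < A.card → C ⊆ A ∧ KT k G (A.erase x) := by
  induction h with
  | base D h => intro x C _ _ _ hk; have := h.card_eq; omega
  | step S y D hS h ih =>
    intro x C hx hC hN hk
    by_cases hxy : x = y
    · subst hxy
      have hDC : D ⊆ C := fun w hw =>
        hN w (Finset.mem_insert_of_mem (h.subset hw)) ((h.adj w (h.subset hw)).2 hw)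
      have : D = C := Finset.eq_of_subset_of_card_le hDC (by rw [hC, h.clique.card_eq])
      subst this
      exact ⟨h.subset.trans (Finset.subset_insert _ _), by
        rwa [Finset.erase_insert h.notMem]⟩
    · have hxS : x ∈ S := (Finset.mem_insert.1 hx).resolve_left hxy
      rcases hS.card_le.lt_or_eq with hlt | heq
      · obtain ⟨h1, h2⟩ := ih hxS hC (fun w hw => hN w (Finset.mem_insert_of_mem hw)) hlt
        refine ⟨h1.trans (Finset.subset_insert _ _), ?_⟩
        -- If `x` were in `D`, then `y` would be a neighbour of `x` and so lie in `C ⊆ S`.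
        have hxD : x ∉ D := fun hxD => h.notMem <| h1 <|
          hN y (Finset.mem_insert_self _ _) ((h.adj x hxS).2 hxD).symm
        rw [Finset.erase_insert_of_ne (Ne.symm hxy)]
        exact KT.step _ y D h2 (h.mono (Finset.erase_subset _ _)
          (fun w hw => Finset.mem_erase.2 ⟨fun e => hxD (e ▸ hw), h.subset hw⟩))
      -- Now the whole set is a `(k+1)`-clique, and deleting any vertex leaves a `k`-clique.
      · have hDS : D = S :=
          Finset.eq_of_subset_of_card_le h.subset (by rw [← heq, h.clique.card_eq])
        subst hDS
        have hcl := h.isNClique_new hxS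
        have he : (insert y D).erase x = insert y (D.erase x) :=
          Finset.erase_insert_of_ne (Ne.symm hxy)
        refine ⟨?_, he ▸ KT.base _ hcl⟩
        have hsub : insert y (D.erase x) ⊆ C := by
          intro w hw
          have hw' : w ∈ (insert y D).erase x := he ▸ hw
          exact hN w (Finset.mem_of_mem_erase hw')
            (h.isNClique_insert.isClique (by exact_mod_cast hx)
              (by exact_mod_cast Finset.mem_of_mem_erase hw') (Finset.ne_of_mem_erase hw').symm)
        rw [← Finset.eq_of_subset_of_card_le hsub (by rw [hC, hcl.card_eq])]
        exact Finset.insert_subset_insert _ (Finset.erase_subset _ _)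

theorem KT.of_isNClique_succ {e : Finset V} (he : G.IsNClique (k + 1) e) : KT k G e := by
  have hne : e.Nonempty := Finset.card_pos.1 (by rw [he.card_eq]; omega)
  obtain ⟨v, hv⟩ := hne
  have hc : G.IsNClique k (e.erase v) := by
    refine ⟨he.isClique.subset (by exact_mod_cast Finset.erase_subset v e), ?_⟩
    rw [Finset.card_erase_of_mem hv, he.card_eq]; rfl
  rw [← Finset.insert_erase hv]
  refine KT.step _ v _ (KT.base _ hc) ⟨Finset.notMem_erase _ _, subset_rfl, hc, fun w hw => ?_⟩
  refine ⟨fun _ => hw, fun _ => he.isClique (by exact_mod_cast hv)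
    (by exact_mod_cast Finset.mem_of_mem_erase hw) (Finset.ne_of_mem_erase hw).symm⟩

/-- A `k`-tree grows from each of its proper sub-`k`-trees. -/
theorem KT.exists_step {S : Finset V} (h : KT k G S) :
    ∀ {S₀ : Finset V}, KT k G S₀ → S₀ ⊆ S → S₀ ≠ S →
      ∃ S' v C, KT k G S' ∧ S₀ ⊆ S' ∧ IsStep k G S' v C ∧ S = insert v S' := by
  induction h with
  | base C h =>
    intro S₀ h₀ hs hne
    exact absurd (Finset.eq_of_subset_of_card_le hs (h.card_eq.le.trans h₀.card_le)) hne
  | step S x C hS h ih =>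
    intro S₀ h₀ hs hne
    by_cases hx : x ∈ S₀
    swap
    · exact ⟨S, x, C, hS, fun w hw => (Finset.mem_insert.1 (hs hw)).resolve_left
        (fun e => hx (e ▸ hw)), h, rfl⟩
    -- it suffices to grow `S` from a sub-`k`-tree that contains `C` and `S₀ - x`
    have key : ∀ S₁, KT k G S₁ → C ⊆ S₁ → S₀.erase x ⊆ S₁ → S₁ ⊆ S → S₁ ≠ S →
        ∃ S' v D, KT k G S' ∧ S₀ ⊆ S' ∧ IsStep k G S' v D ∧ insert x S = insert v S' := by
      intro S₁ h₁ hC h01 h1S hne1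
      obtain ⟨S', v, D, hS', hsub, hst, rfl⟩ := ih h₁ h1S hne1
      have hvx : v ≠ x := fun e => h.notMem (e ▸ Finset.mem_insert_self _ _)
      have hvC : v ∉ C := fun hv => hst.notMem (hsub (hC hv))
      have hxS' : x ∉ S' := fun hx' => h.notMem (Finset.mem_insert_of_mem hx')
      have hvx' : ¬ G.Adj v x := fun ha =>
        hvC ((h.adj v (Finset.mem_insert_self _ _)).1 ha.symm)
      refine ⟨insert x S', v, D, KT.step _ x C hS'
        (h.mono (Finset.subset_insert _ _) (hC.trans hsub)), ?_, ?_, Finset.insert_comm _ _ _⟩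
      · intro w hw
        by_cases hwx : w = x
        · exact hwx ▸ Finset.mem_insert_self _ _
        · exact Finset.mem_insert_of_mem (hsub (h01 (Finset.mem_erase.2 ⟨hwx, hw⟩)))
      · refine ⟨?_, hst.subset.trans (Finset.subset_insert _ _), hst.clique, ?_⟩
        · simp [hvx, hst.notMem]
        · intro w hw
          rcases Finset.mem_insert.1 hw with rfl | hw
          · exact ⟨fun ha => absurd ha hvx', fun hwD => absurd (hst.subset hwD) hxS'⟩
          · exact hst.adj w hw
    have hN : ∀ w ∈ S₀, G.Adj x w → w ∈ C := by
      intro w hw ha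
      have : w ∈ S := (Finset.mem_insert.1 (hs hw)).resolve_left (fun e => ha.ne e.symm)
      exact (h.adj w this).1 ha
    have hsE : S₀.erase x ⊆ S := fun w hw =>
      (Finset.mem_insert.1 (hs (Finset.mem_of_mem_erase hw))).resolve_left
        (Finset.ne_of_mem_erase hw)
    rcases h₀.card_le.lt_or_eq with hlt | heq
    · obtain ⟨h1, h2⟩ := h₀.remove hx h.clique.card_eq hN hlt
      refine key _ h2 (fun w hw => Finset.mem_erase.2
        ⟨fun e => h.notMem_clique (e ▸ hw), h1 hw⟩) subset_rfl hsE ?_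
      intro e
      exact hne (by rw [← e, Finset.insert_erase hx])
    · have hcl := h₀.isNClique_of_card heq.symm
      have hEC : S₀.erase x ⊆ C := fun w hw => hN w (Finset.mem_of_mem_erase hw)
        (hcl.isClique (by exact_mod_cast hx) (by exact_mod_cast Finset.mem_of_mem_erase hw)
          (Finset.ne_of_mem_erase hw).symm)
      -- Here `S₀` is a `k`-clique through `x`. If `C = S`, the whole set is a `(k+1)`-clique and
      -- the one vertex missing from `S₀` comes last; otherwise `C` itself can serve as the smaller
      -- tree.
      by_cases hCS : C = S
      · subst hCS
        have hcard : (S₀.erase x).card + 1 = C.card := by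
          rw [Finset.card_erase_add_one hx, ← heq, h.clique.card_eq]
        obtain ⟨w, hwC, hwE⟩ : ∃ w ∈ C, w ∉ S₀.erase x := by
          by_contra! hcon
          have := Finset.card_le_card (show C ⊆ S₀.erase x from hcon)
          omega
        have hE : S₀.erase x = C.erase w := by
          refine Finset.eq_of_subset_of_card_le (fun y hy => Finset.mem_erase.2
            ⟨fun e => hwE (e ▸ hy), hEC hy⟩) ?_
          rw [Finset.card_erase_of_mem hwC]; omega
        have hS₀ : S₀ = insert x (C.erase w) := by rw [← hE, Finset.insert_erase hx]
        have hwx : w ≠ x := fun e => h.notMem (e ▸ hwC)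
        refine ⟨S₀, w, S₀, h₀, subset_rfl, ⟨?_, subset_rfl, hcl, fun y hy => ⟨fun _ => hy, ?_⟩⟩, ?_⟩
        · rw [hS₀]; simp [hwx]
        · intro _
          have hyw : w ≠ y := by rintro rfl; rw [hS₀] at hy; simp [hwx] at hy
          refine h.isNClique_insert.isClique ?_ ?_ hyw
          · exact_mod_cast Finset.mem_insert_of_mem hwC
          · exact_mod_cast hs hy
        · rw [hS₀, Finset.insert_comm, Finset.insert_erase hwC]
      · exact key C (KT.base _ h.clique) subset_rfl hEC h.subset hCS

/-- Lets any sub-`k`-tree be the root of an induction: it is present from the start, and every later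
step adds a vertex outside it. -/
theorem KT.grow_induction {S₀ : Finset V} (h₀ : KT k G S₀) {motive : Finset V → Prop}
    (base : motive S₀)
    (step : ∀ S v C, KT k G S → S₀ ⊆ S → IsStep k G S v C → motive S → motive (insert v S)) :
    ∀ {S : Finset V}, KT k G S → S₀ ⊆ S → motive S := by
  intro S
  induction hn : S.card using Nat.strong_induction_on generalizing S with
  | _ n ih =>
    intro hS hs
    by_cases he : S₀ = S
    · exact he ▸ base
    · obtain ⟨S', v, C, h1, h2, h3, rfl⟩ := hS.exists_step h₀ hs he
      rw [Finset.card_insert_of_notMem h3.notMem] at hn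
      exact step S' v C h1 h2 h3 (ih S'.card (by omega) rfl h1 h2)

/-- A vertex of a `k`-tree that is joined to a `k`-clique of a sub-`k`-tree has no further
neighbours in it. -/
theorem KT.isStep_of_adj {S A : Finset V} (hS : KT k G S) (hA : KT k G A) (hAS : A ⊆ S)
    {y : V} {C : Finset V} (hy : y ∈ S) (hyA : y ∉ A) (hC : G.IsNClique k C) (hCA : C ⊆ A)
    (hadj : ∀ w ∈ C, G.Adj y w) : IsStep k G A y C := by
  refine hA.grow_induction (motive := fun S => y ∈ S → IsStep k G A y C) ?_ ?_ hS hAS hy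
  · exact fun h => absurd h hyA
  · intro S v D _ hs hst ih hy
    rcases Finset.mem_insert.1 hy with rfl | hy
    · have hCD : C ⊆ D := fun w hw => (hst.adj w (hs (hCA hw))).1 (hadj w hw)
      obtain rfl : C = D :=
        Finset.eq_of_subset_of_card_le hCD (by rw [hC.card_eq, hst.clique.card_eq])
      exact hst.mono hs hCA
    · exact ih hy

/-- When `S` is grown from `C`, the first new vertex can only be joined to all of `C`. -/
theorem KT.exists_adj_clique {S C : Finset V} (hS : KT k G S) (hC : G.IsNClique k C)
    (hCS : C ⊆ S) (hne : C ≠ S) : ∃ v ∈ S, v ∉ C ∧ ∀ w ∈ C, G.Adj v w := by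
  refine (KT.base C hC).grow_induction
    (motive := fun S => C ≠ S → ∃ v ∈ S, v ∉ C ∧ ∀ w ∈ C, G.Adj v w) (fun h => absurd rfl h)
    ?_ hS hCS hne
  intro S v D _ hs hst ih _
  by_cases hCS : C = S
  · subst hCS
    have hDC : D = C := Finset.eq_of_subset_of_card_le hst.subset
      (by rw [hC.card_eq, hst.clique.card_eq])
    exact ⟨v, Finset.mem_insert_self _ _, hst.notMem,
      fun w hw => (hst.adj w hw).2 (hDC ▸ hw)⟩
  · obtain ⟨x, hx, h⟩ := ih hCS
    exact ⟨x, Finset.mem_insert_of_mem hx, h⟩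

/-! ### Sub-`k`-trees and cliques -/

open Classical in
/-- The vertex sets of the sub-`k`-trees in `S`. -/
noncomputable def Fam (k : ℕ) (G : SimpleGraph V) (S : Finset V) : Finset (Finset V) :=
  S.powerset.filter (KT k G)

open Classical in
/-- The `j`-cliques in `S`. -/
noncomputable def Cl (j : ℕ) (G : SimpleGraph V) (S : Finset V) : Finset (Finset V) :=
  S.powerset.filter (G.IsNClique j)

/-- The degree of `q` in `S`. -/
noncomputable def deg (k : ℕ) (G : SimpleGraph V) (S q : Finset V) : ℕ :=
  ((Cl (k + 1) G S).filter (q ⊆ ·)).card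

/-- The new `k`-cliques that contain a new vertex `v` joined to `C`. -/
def newCl (v : V) (C : Finset V) : Finset (Finset V) := C.image fun x => insert v (C.erase x)

theorem mem_Fam {S A : Finset V} : A ∈ Fam k G S ↔ A ⊆ S ∧ KT k G A := by simp [Fam]

theorem mem_Cl {j : ℕ} {S A : Finset V} : A ∈ Cl j G S ↔ A ⊆ S ∧ G.IsNClique j A := by simp [Cl]

theorem mem_newCl {v : V} {C u : Finset V} :
    u ∈ newCl v C ↔ ∃ x ∈ C, insert v (C.erase x) = u := by simp [newCl]

theorem self_mem_of_mem_newCl {v : V} {C u : Finset V} (h : u ∈ newCl v C) : v ∈ u := by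
  obtain ⟨x, _, rfl⟩ := mem_newCl.1 h
  exact Finset.mem_insert_self _ _

section Step

variable {S C : Finset V} {v : V}

theorem IsStep.injOn_newCl (h : IsStep k G S v C) :
    Set.InjOn (fun x => insert v (C.erase x)) (C : Set V) := by
  intro x hx y hy hxy
  have hv := h.notMem_clique
  by_contra hne
  have : x ∈ insert v (C.erase y) := Finset.mem_insert_of_mem (Finset.mem_erase.2 ⟨hne, hx⟩)
  rw [← show insert v (C.erase x) = insert v (C.erase y) from hxy] at this
  rcases Finset.mem_insert.1 this with e | e
  · exact hv (e ▸ hx)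
  · simp at e

theorem IsStep.card_newCl (h : IsStep k G S v C) : (newCl v C).card = k := by
  rw [newCl, Finset.card_image_of_injOn h.injOn_newCl, h.clique.card_eq]

theorem IsStep.isNClique_of_mem_newCl (h : IsStep k G S v C) {u : Finset V}
    (hu : u ∈ newCl v C) : G.IsNClique k u := by
  obtain ⟨x, hx, rfl⟩ := mem_newCl.1 hu
  exact h.isNClique_new hx

theorem IsStep.subset_insert_of_mem_newCl {u : Finset V}
    (hu : u ∈ newCl v C) : u ⊆ insert v C := by
  obtain ⟨x, hx, rfl⟩ := mem_newCl.1 hu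
  exact Finset.insert_subset_insert _ (Finset.erase_subset _ _)

/-- The cliques through the new vertex. -/
theorem IsStep.erase_subset_of_clique (h : IsStep k G S v C) {q : Finset V}
    (hq : q ⊆ insert v S) (hv : v ∈ q) (hcl : G.IsClique (q : Set V)) : q.erase v ⊆ C := by
  intro w hw
  have hwv := Finset.ne_of_mem_erase hw
  have hwS : w ∈ S := (Finset.mem_insert.1 (hq (Finset.mem_of_mem_erase hw))).resolve_left hwv
  exact (h.adj w hwS).1 (hcl (by exact_mod_cast hv)
    (by exact_mod_cast Finset.mem_of_mem_erase hw) hwv.symm)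

theorem IsStep.mem_newCl_of_clique (h : IsStep k G S v C) {q : Finset V}
    (hq : q ⊆ insert v S) (hv : v ∈ q) (hcl : G.IsNClique k q) : q ∈ newCl v C := by
  have hE := h.erase_subset_of_clique hq hv hcl.isClique
  have hcard : (q.erase v).card + 1 = C.card := by
    rw [Finset.card_erase_add_one hv, hcl.card_eq, h.clique.card_eq]
  obtain ⟨w, hwC, hwE⟩ : ∃ w ∈ C, w ∉ q.erase v := by
    by_contra! hcon
    have := Finset.card_le_card (show C ⊆ q.erase v from hcon)
    omega
  have hE' : q.erase v = C.erase w := by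
    refine Finset.eq_of_subset_of_card_le (fun y hy => Finset.mem_erase.2
      ⟨fun e => hwE (e ▸ hy), hE hy⟩) ?_
    rw [Finset.card_erase_of_mem hwC]; omega
  exact mem_newCl.2 ⟨w, hwC, by rw [← hE', Finset.insert_erase hv]⟩

theorem IsStep.Cl_insert (h : IsStep k G S v C) :
    Cl k G (insert v S) = Cl k G S ∪ newCl v C := by
  ext q
  rw [Finset.mem_union, mem_Cl, mem_Cl]
  constructor
  · rintro ⟨h1, h2⟩
    by_cases hv : v ∈ q
    · exact Or.inr (h.mem_newCl_of_clique h1 hv h2)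
    · exact Or.inl ⟨(Finset.subset_insert_iff_of_notMem hv).1 h1, h2⟩
  · rintro (⟨h1, h2⟩ | h1)
    · exact ⟨h1.trans (Finset.subset_insert _ _), h2⟩
    · exact ⟨(IsStep.subset_insert_of_mem_newCl h1).trans
        (Finset.insert_subset_insert _ h.subset), h.isNClique_of_mem_newCl h1⟩

theorem IsStep.disjoint_newCl (h : IsStep k G S v C) {F : Finset (Finset V)}
    (hF : ∀ A ∈ F, A ⊆ S) : Disjoint F (newCl v C) := by
  rw [Finset.disjoint_left]
  exact fun q hq hq' => h.notMem (hF q hq (self_mem_of_mem_newCl hq'))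

theorem IsStep.Cl_succ_insert (h : IsStep k G S v C) :
    Cl (k + 1) G (insert v S) = insert (insert v C) (Cl (k + 1) G S) := by
  ext q
  rw [Finset.mem_insert, mem_Cl, mem_Cl]
  constructor
  · rintro ⟨h1, h2⟩
    by_cases hv : v ∈ q
    · left
      have hE := h.erase_subset_of_clique h1 hv h2.isClique
      rw [← Finset.eq_of_subset_of_card_le hE, Finset.insert_erase hv]
      rw [Finset.card_erase_of_mem hv, h2.card_eq, h.clique.card_eq]; rfl
    · exact Or.inr ⟨(Finset.subset_insert_iff_of_notMem hv).1 h1, h2⟩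
  · rintro (rfl | ⟨h1, h2⟩)
    · exact ⟨Finset.insert_subset_insert _ h.subset, h.isNClique_insert⟩
    · exact ⟨h1.trans (Finset.subset_insert _ _), h2⟩

theorem IsStep.insert_notMem_Cl (h : IsStep k G S v C) {j : ℕ} {A : Finset V} :
    insert v A ∉ Cl j G S := fun hm =>
  h.notMem ((mem_Cl.1 hm).1 (Finset.mem_insert_self _ _))

/-- The only new `(k+1)`-clique is `insert v C`. Hence among the old `k`-cliques only `C` gains
degree, and the new ones have degree 1. -/
theorem IsStep.deg_insert (h : IsStep k G S v C) (q : Finset V) :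
    deg k G (insert v S) q = deg k G S q + if q ⊆ insert v C then 1 else 0 := by
  unfold deg
  rw [h.Cl_succ_insert, Finset.filter_insert]
  split_ifs with hq
  · rw [Finset.card_insert_of_notMem]
    exact fun hm => h.insert_notMem_Cl (Finset.mem_filter.1 hm).1
  · rfl

theorem IsStep.deg_insert_self (h : IsStep k G S v C) :
    deg k G (insert v S) C = deg k G S C + 1 := by
  rw [h.deg_insert, if_pos (Finset.subset_insert _ _)]

theorem IsStep.deg_insert_of_ne (h : IsStep k G S v C) {q : Finset V} (hq : q ∈ Cl k G S)
    (hne : q ≠ C) : deg k G (insert v S) q = deg k G S q := by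
  rw [h.deg_insert, if_neg, add_zero]
  intro hs
  obtain ⟨h1, h2⟩ := mem_Cl.1 hq
  exact hne (Finset.eq_of_subset_of_card_le
    ((Finset.subset_insert_iff_of_notMem (fun hv => h.notMem (h1 hv))).1 hs)
    (by rw [h2.card_eq, h.clique.card_eq]))

theorem IsStep.deg_insert_new (h : IsStep k G S v C) {u : Finset V} (hu : u ∈ newCl v C) :
    deg k G (insert v S) u = 1 := by
  rw [h.deg_insert, if_pos (IsStep.subset_insert_of_mem_newCl hu), deg,
    Finset.card_eq_zero.2]
  exact Finset.filter_eq_empty_iff.2 fun B hB hs =>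
    h.notMem ((mem_Cl.1 hB).1 (hs (self_mem_of_mem_newCl hu)))

theorem IsStep.mem_Cl (h : IsStep k G S v C) : C ∈ Cl k G S :=
  SubKTree.mem_Cl.2 ⟨h.subset, h.clique⟩

/-- A sub-`k`-tree through `v` with more than k vertices must contain `C` and stays a `k`-tree
without `v`, by `KT.remove`; one with exactly k vertices is a new clique. -/
theorem IsStep.mem_Fam_insert (h : IsStep k G S v C) {A : Finset V} :
    A ∈ Fam k G (insert v S) ↔
      A ∈ Fam k G S ∨ A ∈ newCl v C ∨ ∃ B ∈ Fam k G S, C ⊆ B ∧ insert v B = A := by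
  constructor
  · intro hA
    obtain ⟨h1, h2⟩ := mem_Fam.1 hA
    by_cases hv : v ∈ A
    · right
      rcases h2.card_le.lt_or_eq with hlt | heq
      · right
        have hN : ∀ w ∈ A, G.Adj v w → w ∈ C := fun w hw ha =>
          (h.adj w ((Finset.mem_insert.1 (h1 hw)).resolve_left (fun e => ha.ne e.symm))).1 ha
        obtain ⟨h3, h4⟩ := h2.remove hv h.clique.card_eq hN hlt
        refine ⟨A.erase v, mem_Fam.2 ⟨?_, h4⟩, ?_, Finset.insert_erase hv⟩
        · exact fun w hw => (Finset.mem_insert.1 (h1 (Finset.mem_of_mem_erase hw))).resolve_left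
            (Finset.ne_of_mem_erase hw)
        · exact fun w hw => Finset.mem_erase.2 ⟨fun e => h.notMem_clique (e ▸ hw), h3 hw⟩
      · exact Or.inl (h.mem_newCl_of_clique h1 hv (h2.isNClique_of_card heq.symm))
    · exact Or.inl (mem_Fam.2 ⟨(Finset.subset_insert_iff_of_notMem hv).1 h1, h2⟩)
  · rintro (hA | hA | ⟨B, hB, hC, rfl⟩)
    · obtain ⟨h1, h2⟩ := mem_Fam.1 hA
      exact mem_Fam.2 ⟨h1.trans (Finset.subset_insert _ _), h2⟩
    · have h' := h.Cl_insert
      have : A ∈ Cl k G (insert v S) := by rw [h']; exact Finset.mem_union_right _ hA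
      exact mem_Fam.2 ⟨(SubKTree.mem_Cl.1 this).1, KT.base _ (SubKTree.mem_Cl.1 this).2⟩
    · obtain ⟨h1, h2⟩ := mem_Fam.1 hB
      exact mem_Fam.2 ⟨Finset.insert_subset_insert _ h1, KT.step _ v C h2 (h.mono h1 hC)⟩

/-- The recursion behind all counts below. The three families are disjoint: `v` separates the old
sets from the rest, and `insert v B` has more than k vertices, unlike a new clique. -/
theorem IsStep.sum_Fam_insert (h : IsStep k G S v C) {M : Type*}
    [AddCommMonoid M] (Φ : Finset V → M) :
    ∑ A ∈ Fam k G (insert v S), Φ A =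
      ∑ A ∈ Fam k G S, (Φ A + if C ⊆ A then Φ (insert v A) else 0) + ∑ u ∈ newCl v C, Φ u := by
  have hF : ∀ A ∈ Fam k G S, v ∉ A := fun A hA hv => h.notMem ((mem_Fam.1 hA).1 hv)
  have hinj : Set.InjOn (fun A : Finset V => insert v A)
      ((Fam k G S).filter (C ⊆ ·) : Set (Finset V)) := by
    intro A hA B hB hAB
    have hA' := hF A (Finset.mem_filter.1 hA).1
    have hB' := hF B (Finset.mem_filter.1 hB).1
    rw [← Finset.erase_insert hA', ← Finset.erase_insert hB']
    exact congrArg (Finset.erase · v) hAB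
  have hset : Fam k G (insert v S) = (Fam k G S ∪
      ((Fam k G S).filter (C ⊆ ·)).image (fun A : Finset V => insert v A)) ∪ newCl v C := by
    ext A
    rw [h.mem_Fam_insert]
    simp only [Finset.mem_union, Finset.mem_image, Finset.mem_filter, and_assoc, or_assoc]
    exact or_congr_right or_comm
  have hd1 : Disjoint (Fam k G S)
      (((Fam k G S).filter (C ⊆ ·)).image (fun A : Finset V => insert v A)) := by
    rw [Finset.disjoint_left]
    intro A hA hA'
    obtain ⟨B, _, rfl⟩ := Finset.mem_image.1 hA'
    exact hF _ hA (Finset.mem_insert_self _ _)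
  have hd2 : Disjoint (Fam k G S ∪
      ((Fam k G S).filter (C ⊆ ·)).image (fun A : Finset V => insert v A)) (newCl v C) := by
    rw [Finset.disjoint_union_left]
    refine ⟨h.disjoint_newCl fun A hA => (mem_Fam.1 hA).1, ?_⟩
    rw [Finset.disjoint_left]
    intro A hA hA'
    obtain ⟨B, hB, rfl⟩ := Finset.mem_image.1 hA
    obtain ⟨hB, hCB⟩ := Finset.mem_filter.1 hB
    have h1 := (h.isNClique_of_mem_newCl hA').card_eq
    rw [Finset.card_insert_of_notMem (hF B hB)] at h1
    have := (mem_Fam.1 hB).2.card_le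
    omega
  rw [hset, Finset.sum_union hd2, Finset.sum_union hd1, Finset.sum_image hinj,
    Finset.sum_add_distrib, Finset.sum_filter]

end Step

theorem Cl_self {C : Finset V} (h : G.IsNClique k C) : Cl k G C = {C} := by
  ext q
  rw [mem_Cl, Finset.mem_singleton]
  constructor
  · rintro ⟨h1, h2⟩
    exact Finset.eq_of_subset_of_card_le h1 (by rw [h.card_eq, h2.card_eq])
  · rintro rfl; exact ⟨subset_rfl, h⟩

theorem Fam_self {C : Finset V} (h : G.IsNClique k C) : Fam k G C = {C} := by
  ext q
  rw [mem_Fam, Finset.mem_singleton]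
  constructor
  · rintro ⟨h1, h2⟩
    exact Finset.eq_of_subset_of_card_le h1 (by rw [h.card_eq]; exact h2.card_le)
  · rintro rfl; exact ⟨subset_rfl, KT.base _ h⟩

theorem Cl_succ_self {C : Finset V} (h : G.IsNClique k C) : Cl (k + 1) G C = ∅ := by
  rw [Finset.eq_empty_iff_forall_notMem]
  intro q hq
  obtain ⟨h1, h2⟩ := mem_Cl.1 hq
  have := Finset.card_le_card h1
  rw [h.card_eq, h2.card_eq] at this
  omega

theorem deg_self {C : Finset V} (h : G.IsNClique k C) (q : Finset V) : deg k G C q = 0 := by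
  simp [deg, Cl_succ_self h]

/-- Each step creates exactly one `(k+1)`-clique. This lets orders be computed by counting
`(k+1)`-cliques. -/
theorem KT.card_Cl_succ {S : Finset V} (h : KT k G S) : (Cl (k + 1) G S).card + k = S.card := by
  induction h with
  | base C h => simp [Cl_succ_self h, h.card_eq]
  | step S v C hS h ih =>
    rw [h.Cl_succ_insert, Finset.card_insert_of_notMem h.insert_notMem_Cl,
      Finset.card_insert_of_notMem h.notMem]
    omega

end SubKTree

/-! ### Passing between abstract `k`-trees and vertex sets -/

namespace SubKTree

theorem isNClique_map_embedding {V : Type u} {W : Type v} {G : SimpleGraph V} {H : SimpleGraph W}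
    (f : G ↪g H) {n : ℕ} {C : Finset V} (h : G.IsNClique n C) :
    H.IsNClique n (C.map f.toEmbedding) := by
  refine ⟨?_, by rw [Finset.card_map, h.card_eq]⟩
  intro x hx y hy hne
  simp only [Finset.coe_map, Set.mem_image, Finset.mem_coe] at hx hy
  obtain ⟨a, ha, rfl⟩ := hx
  obtain ⟨b, hb, rfl⟩ := hy
  exact f.map_adj_iff.2 (h.isClique ha hb fun e => hne (by rw [e]))

theorem isKTree_iso {k : ℕ} {V : Type u} {G : SimpleGraph V} (h : IsKTree k G) :
    ∀ {W : Type v} {H : SimpleGraph W}, (G ≃g H) → IsKTree k H := by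
  induction h with
  | complete G h =>
    intro W H e
    obtain ⟨g⟩ := h
    exact IsKTree.complete H ⟨e.symm.trans g⟩
  | join G v C hC hv h ih =>
    intro W H e
    refine IsKTree.join H (e v) _ (isNClique_map_embedding e.toEmbedding hC) ?_ ?_
    · intro w
      obtain ⟨w, rfl⟩ := e.surjective w
      rw [e.map_adj_iff, hv]
      simp only [Finset.mem_map]
      exact ⟨fun hw => ⟨w, hw, rfl⟩, fun ⟨a, ha, hw⟩ => e.injective hw ▸ ha⟩
    · refine ih ⟨Equiv.subtypeEquiv e.toEquiv ?_, ?_⟩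
      · intro a; simp
      · intro a b; exact e.map_adj_iff

section

variable {V : Type u} [DecidableEq V] {W : Type v} [DecidableEq W] {k : ℕ}
  {G : SimpleGraph V} {H : SimpleGraph W}

theorem IsStep.map (f : G ↪g H) {S C : Finset V} {v : V} (h : IsStep k G S v C) :
    IsStep k H (S.map f.toEmbedding) (f v) (C.map f.toEmbedding) where
  notMem hv := h.notMem (by simpa using hv)
  subset := Finset.map_subset_map.2 h.subset
  clique := isNClique_map_embedding f h.clique
  adj w hw := by
    obtain ⟨w, hw', rfl⟩ := Finset.mem_map.1 hw
    refine (f.map_adj_iff).trans ((h.adj w hw').trans ?_)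
    simp

theorem KT.map (f : G ↪g H) {S : Finset V} (h : KT k G S) : KT k H (S.map f.toEmbedding) := by
  induction h with
  | base C h => exact KT.base _ (isNClique_map_embedding f h)
  | step S v C hS h ih =>
    rw [Finset.map_insert]
    exact KT.step _ _ _ ih (h.map f)

end

/-- Stated for an embedding because the induction passes to a vertex-deleted graph on another type
while the ambient `G` stays fixed. -/
theorem exists_KT_of_isKTree {k : ℕ} {W : Type v} {H : SimpleGraph W} (h : IsKTree k H) :
    ∀ {V : Type u} [DecidableEq V] {G : SimpleGraph V} (f : H ↪g G),
      ∃ S : Finset V, (S : Set V) = Set.range f ∧ KT k G S := by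
  induction h with
  | complete H h =>
    intro V _ G f
    obtain ⟨g⟩ := h
    have hT : (⊤ : SimpleGraph (Fin k)).IsNClique k Finset.univ :=
      ⟨fun a _ b _ hne => hne, by simp⟩
    refine ⟨_, ?_, KT.base _ (isNClique_map_embedding (g.symm.toEmbedding.trans f) hT)⟩
    ext x
    simp only [Finset.coe_map, Finset.coe_univ, Set.image_univ, Set.mem_range]
    constructor
    · rintro ⟨a, rfl⟩
      exact ⟨g.symm a, rfl⟩
    · rintro ⟨a, rfl⟩
      exact ⟨g a, congrArg f (g.symm_apply_apply a)⟩
  | join H v C hC hv h ih =>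
    intro V _ G f
    obtain ⟨S, hS, hKT⟩ := ih ((SimpleGraph.Embedding.induce ({v}ᶜ : Set _)).trans f)
    have hmem : ∀ w, f w ∈ S ↔ w ≠ v := by
      intro w
      rw [← Finset.mem_coe, hS]
      simp
    refine ⟨insert (f v) S, ?_, KT.step _ _ (C.map f.toEmbedding) hKT ⟨?_, ?_,
      isNClique_map_embedding f hC, ?_⟩⟩
    · rw [Finset.coe_insert, hS]
      ext x
      simp only [Set.mem_insert_iff, Set.mem_range]
      constructor
      · rintro (rfl | ⟨a, rfl⟩)
        · exact ⟨v, rfl⟩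
        · exact ⟨a, rfl⟩
      · rintro ⟨a, rfl⟩
        by_cases ha : a = v
        · exact Or.inl (by rw [ha])
        · exact Or.inr ⟨⟨a, ha⟩, rfl⟩
    · rw [hmem]; simp
    · intro x hx
      obtain ⟨a, ha, rfl⟩ := Finset.mem_map.1 hx
      exact (hmem a).2 ((hv a).2 ha).ne'
    · intro w hw
      have : w ∈ (S : Set V) := hw
      rw [hS] at this
      obtain ⟨a, rfl⟩ := this
      refine f.map_adj_iff.trans ((hv _).trans ?_)
      simp

/-- Sub-`k`-trees of a `k`-tree are induced subgraphs. -/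
theorem adj_of_isKTree {k : ℕ} {W : Type v} {H : SimpleGraph W} (h : IsKTree k H) :
    ∀ {V : Type u} [DecidableEq V] {G : SimpleGraph V} {S : Finset V} (_ : KT k G S) (f : W → V)
      (_ : Function.Injective f) (_ : ∀ a, f a ∈ S) (_ : ∀ a b, H.Adj a b → G.Adj (f a) (f b))
      (a b : W), G.Adj (f a) (f b) → H.Adj a b := by
  induction h with
  | complete H h =>
    intro V _ G S hS f hf hfS hom a b hab
    obtain ⟨g⟩ := h
    refine g.map_adj_iff.1 ?_
    rw [SimpleGraph.top_adj]
    exact fun e => hab.ne (by rw [g.injective e])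
  | join H v C hC hv h ih =>
    intro V _ G S hS f hf hfS hom a b hab
    have hi := ih hS (fun x => f x.1) (fun x y hxy => Subtype.ext (hf hxy)) (fun x => hfS x.1)
      (fun x y hxy => hom _ _ hxy)
    let e : H.induce ({v}ᶜ : Set _) ↪g G :=
      ⟨⟨fun x => f x.1, fun x y hxy => Subtype.ext (hf hxy)⟩, fun {x y} => ⟨hi x y, hom _ _⟩⟩
    obtain ⟨A, hA, hKT⟩ := exists_KT_of_isKTree h e
    have hmem : ∀ w, f w ∈ A ↔ w ≠ v := by
      intro w
      rw [← Finset.mem_coe, hA, Set.mem_range]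
      constructor
      · rintro ⟨x, hx⟩ rfl
        exact x.2 (hf hx)
      · intro hw
        exact ⟨⟨w, hw⟩, rfl⟩
    have hAS : A ⊆ S := by
      intro x hx
      have : x ∈ (A : Set V) := hx
      rw [hA] at this
      obtain ⟨y, rfl⟩ := this
      exact hfS _
    let fe : _ ↪ V := ⟨f, hf⟩
    have hCf : G.IsNClique k (C.map fe) := by
      refine ⟨?_, by rw [Finset.card_map, hC.card_eq]⟩
      intro x hx y hy hne
      simp only [Finset.coe_map, Set.mem_image, Finset.mem_coe] at hx hy
      obtain ⟨a, ha, rfl⟩ := hx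
      obtain ⟨b, hb, rfl⟩ := hy
      exact hom _ _ (hC.isClique ha hb fun e => hne (by rw [e]))
    -- By induction `H - v` embeds as an induced subgraph with vertex set `A`. As `f v` is joined to
    -- the `k`-clique image of `C`, it has no further neighbours in `A`, so no edge at `v` is
    -- missing from `H`.
    have hst := hS.isStep_of_adj hKT hAS (hfS v) (by rw [hmem]; simp) hCf
      (by
        intro x hx
        obtain ⟨a, ha, rfl⟩ := Finset.mem_map.1 hx
        exact (hmem a).2 ((hv a).2 ha).ne')
      (by
        intro x hx
        obtain ⟨a, ha, rfl⟩ := Finset.mem_map.1 hx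
        exact hom _ _ ((hv a).2 ha))
    have hvw : ∀ w, w ≠ v → G.Adj (f v) (f w) → H.Adj v w := by
      intro w hw ha
      rw [hv]
      have := (hst.adj (f w) ((hmem w).2 hw)).1 ha
      obtain ⟨c, hc, hcw⟩ := Finset.mem_map.1 this
      exact hf hcw ▸ hc
    by_cases hav : a = v
    · subst hav
      exact hvw b (fun e => hab.ne (by rw [e])) hab
    · by_cases hbv : b = v
      · subst hbv
        exact (hvw a hav hab.symm).symm
      · exact hi ⟨a, hav⟩ ⟨b, hbv⟩ hab

theorem KT.isKTree_induce {V : Type u} [DecidableEq V] {k : ℕ} {G : SimpleGraph V} {S : Finset V}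
    (h : KT k G S) : IsKTree k (G.induce (S : Set V)) := by
  induction h with
  | base C h =>
    refine IsKTree.complete _ ⟨⟨C.equivFinOfCardEq h.card_eq, ?_⟩⟩
    intro a b
    rw [SimpleGraph.top_adj]
    refine ⟨fun hne => h.isClique a.2 b.2 fun e => hne (by rw [Subtype.ext e]), fun hab e => ?_⟩
    exact hab.ne ((C.equivFinOfCardEq h.card_eq).injective e)
  | step S v C hS h ih =>
    have hsub : ∀ x ∈ C, x ∈ ((insert v S : Finset V) : Set V) := fun x hx =>
      Finset.mem_coe.2 (Finset.mem_insert_of_mem (h.subset hx))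
    refine IsKTree.join _ ⟨v, Finset.mem_coe.2 (Finset.mem_insert_self _ _)⟩
      (C.attach.map ⟨fun x => ⟨x.1, hsub _ x.2⟩, fun x y hxy => Subtype.ext (by simpa using hxy)⟩)
      ⟨?_, by rw [Finset.card_map, Finset.card_attach, h.clique.card_eq]⟩ ?_ ?_
    · intro x hx y hy hne
      simp only [Finset.coe_map, Set.mem_image, Finset.mem_coe] at hx hy
      obtain ⟨a, ha, rfl⟩ := hx
      obtain ⟨b, hb, rfl⟩ := hy
      exact h.clique.isClique a.2 b.2 fun e => hne (congrArg _ (Subtype.ext e))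
    · rintro ⟨w, hw⟩
      have : G.Adj v w ↔ w ∈ C := by
        rcases Finset.mem_insert.1 (Finset.mem_coe.1 hw) with rfl | hw
        · simp [h.notMem_clique]
        · exact h.adj w hw
      refine Iff.trans this ?_
      simp only [Finset.mem_map, Finset.mem_attach, true_and, Subtype.exists]
      exact ⟨fun hw => ⟨w, hw, rfl⟩, by
        rintro ⟨a, ha, e⟩
        obtain rfl : a = w := congrArg Subtype.val e
        exact ha⟩
    · refine isKTree_iso ih ⟨⟨fun x => ⟨⟨x.1, ?_⟩, ?_⟩, fun x => ⟨x.1.1, ?_⟩, ?_, ?_⟩, ?_⟩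
      · exact Finset.mem_coe.2 (Finset.mem_insert_of_mem x.2)
      · intro e
        have : x.1 = v := congrArg Subtype.val e
        exact h.notMem (this ▸ x.2)
      · have h1 := x.1.2
        have h2 : x.1.1 ≠ v := fun e => x.2 (Subtype.ext e)
        exact (Finset.mem_insert.1 (Finset.mem_coe.1 h1)).resolve_left h2
      · intro x; rfl
      · intro x; rfl
      · intro a b; rfl

variable {V : Type u} [Fintype V] [DecidableEq V] {k : ℕ} {G : SimpleGraph V}

theorem isKTree_iff_KT_univ : IsKTree k G ↔ KT k G Finset.univ := by
  constructor
  · intro h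
    obtain ⟨S, hS, hK⟩ := exists_KT_of_isKTree h (SimpleGraph.Embedding.refl)
    have : S = Finset.univ := by
      rw [← Finset.coe_inj, hS]
      ext x
      simp only [Set.mem_range, Finset.coe_univ, Set.mem_univ, iff_true]
      exact ⟨x, rfl⟩
    exact this ▸ hK
  · intro h
    have := h.isKTree_induce
    rw [Finset.coe_univ] at this
    exact isKTree_iso this (SimpleGraph.induceUnivIso G)

theorem noCliqueOfDegreeTwo_iff :
    NoCliqueOfDegreeTwo k G ↔ ∀ C ∈ Cl k G Finset.univ, deg k G Finset.univ C ≠ 2 := by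
  have : ∀ C, cliqueDegree k G C = deg k G Finset.univ C := by
    intro C
    rw [cliqueDegree, deg, ← Set.ncard_coe_finset]
    congr 1
    ext B
    simp [mem_Cl]
  simp [NoCliqueOfDegreeTwo, mem_Cl, this]

/-- Being induced, a sub-`k`-tree is determined by its vertex set. The general `f` covers both the
count and the total order. -/
theorem sum_subKTrees (hG : KT k G Finset.univ) (f : ℕ → ℝ) :
    ∑ H ∈ subKTrees k G, f H.verts.ncard = ∑ A ∈ Fam k G Finset.univ, f A.card := by
  classical
  refine Finset.sum_nbij' (fun H => H.verts.toFinset)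
    (fun A => (⊤ : G.Subgraph).induce (A : Set V)) ?_ ?_ ?_ ?_ ?_
  · intro H hH
    rw [subKTrees, Set.Finite.mem_toFinset] at hH
    have hadj := adj_of_isKTree hH hG (fun x => x.1) Subtype.val_injective (by simp)
      (fun a b hab => H.adj_sub hab)
    obtain ⟨S, hS, hK⟩ := exists_KT_of_isKTree hH (G := G)
      ⟨⟨fun x => x.1, Subtype.val_injective⟩, fun {a b} => ⟨hadj a b, fun hab => H.adj_sub hab⟩⟩
    have : S = H.verts.toFinset := by
      rw [← Finset.coe_inj, hS]
      ext x; simp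
    exact mem_Fam.2 ⟨Finset.subset_univ _, this ▸ hK⟩
  · intro A hA
    rw [subKTrees, Set.Finite.mem_toFinset]
    have := (mem_Fam.1 hA).2.isKTree_induce
    rwa [SimpleGraph.induce_eq_coe_induce_top] at this
  · intro H hH
    rw [subKTrees, Set.Finite.mem_toFinset] at hH
    have hadj := adj_of_isKTree hH hG (fun x => x.1) Subtype.val_injective (by simp)
      (fun a b hab => H.adj_sub hab)
    ext a b
    · simp
    · simp only [SimpleGraph.Subgraph.induce_adj, Set.coe_toFinset, SimpleGraph.Subgraph.top_adj]
      constructor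
      · rintro ⟨ha, hb, hab⟩
        exact hadj ⟨a, ha⟩ ⟨b, hb⟩ hab
      · intro hab
        exact ⟨H.edge_vert hab, H.edge_vert hab.symm, H.adj_sub hab⟩
  · intro A hA
    simp
  · intro H hH
    rw [Set.ncard_eq_toFinset_card']

theorem globalMean_eq (hG : KT k G Finset.univ) :
    globalMean k G = (∑ A ∈ Fam k G Finset.univ, (A.card : ℝ)) / (Fam k G Finset.univ).card := by
  have h1 := sum_subKTrees hG (fun n => (n : ℝ))
  have h2 := sum_subKTrees hG (fun _ => 1)
  simp only [Finset.sum_const, nsmul_eq_mul, mul_one] at h2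
  rw [globalMean, h1, h2]

end SubKTree

namespace SubKTree

variable {V : Type*} [DecidableEq V] {k : ℕ} {G : SimpleGraph V}

/-! ### Weighted counts -/

/-- The product of the weights of the `k`-cliques in `A`. -/
noncomputable def wt (k : ℕ) (G : SimpleGraph V) (w : Finset V → ℝ) (A : Finset V) : ℝ :=
  ∏ q ∈ Cl k G A, w q

/-- The weights after the new vertex `v`, joined to `C`, has been absorbed into `C`. -/
noncomputable def absorb (v : V) (C : Finset V) (w : Finset V → ℝ) : Finset V → ℝ :=
  Function.update w C (w C * (1 + ∏ u ∈ newCl v C, w u))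

theorem IsStep.wt_insert {A C : Finset V} {v : V} (h : IsStep k G A v C) (w : Finset V → ℝ) :
    wt k G w (insert v A) = wt k G w A * ∏ u ∈ newCl v C, w u := by
  rw [wt, h.Cl_insert, Finset.prod_union (h.disjoint_newCl fun q hq => (SubKTree.mem_Cl.1 hq).1)]
  rfl

theorem wt_update {A C : Finset V} (hC : G.IsNClique k C) (w : Finset V → ℝ) (a : ℝ) :
    wt k G (Function.update w C (w C * a)) A = wt k G w A * if C ⊆ A then a else 1 := by
  unfold wt
  split_ifs with hCA
  · have hm : C ∈ Cl k G A := mem_Cl.2 ⟨hCA, hC⟩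
    rw [← Finset.mul_prod_erase _ _ hm, ← Finset.mul_prod_erase _ w hm, Function.update_self,
      Finset.prod_congr rfl fun q hq => Function.update_of_ne (Finset.ne_of_mem_erase hq) _ w]
    ring
  · rw [mul_one]
    refine Finset.prod_congr rfl fun q hq => Function.update_of_ne ?_ _ w
    rintro rfl
    exact hCA (mem_Cl.1 hq).1

theorem wt_clique {C : Finset V} (hC : G.IsNClique k C) (w : Finset V → ℝ) :
    wt k G w C = w C := by
  rw [wt, Cl_self hC, Finset.prod_singleton]

theorem sum_update_Cl {A C : Finset V} (hC : G.IsNClique k C) {M : Type*} [AddCommMonoid M]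
    (s : Finset V → M) (a : M) :
    ∑ q ∈ Cl k G A, Function.update s C (s C + a) q =
      ∑ q ∈ Cl k G A, s q + if C ⊆ A then a else 0 := by
  split_ifs with hCA
  · have hm : C ∈ Cl k G A := mem_Cl.2 ⟨hCA, hC⟩
    rw [← Finset.add_sum_erase _ _ hm, ← Finset.add_sum_erase _ s hm, Function.update_self,
      Finset.sum_congr rfl fun q hq => Function.update_of_ne (Finset.ne_of_mem_erase hq) _ s]
    abel
  · rw [add_zero]
    refine Finset.sum_congr rfl fun q hq => Function.update_of_ne ?_ _ s
    rintro rfl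
    exact hCA (mem_Cl.1 hq).1

theorem IsStep.sum_Cl_insert {A C : Finset V} {v : V} (h : IsStep k G A v C) {M : Type*}
    [AddCommMonoid M] (s : Finset V → M) :
    ∑ q ∈ Cl k G (insert v A), s q = ∑ q ∈ Cl k G A, s q + ∑ u ∈ newCl v C, s u := by
  rw [h.Cl_insert, Finset.sum_union (h.disjoint_newCl fun q hq => (SubKTree.mem_Cl.1 hq).1)]

section Step

variable {S C : Finset V} {v : V}

theorem IsStep.sum_filter_Fam_insert (h : IsStep k G S v C) (P : Finset V → Prop)
    [DecidablePred P] (hP : ∀ A, C ⊆ A → A ⊆ S → (P (insert v A) ↔ P A)) (Φ Ψ : Finset V → ℝ)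
    (hΨ : ∀ A ∈ Fam k G S, P A → Ψ A = Φ A + if C ⊆ A then Φ (insert v A) else 0) :
    ∑ A ∈ (Fam k G (insert v S)).filter P, Φ A =
      ∑ A ∈ (Fam k G S).filter P, Ψ A + ∑ u ∈ (newCl v C).filter P, Φ u := by
  rw [Finset.sum_filter, h.sum_Fam_insert, Finset.sum_filter, Finset.sum_filter]
  congr 1
  refine Finset.sum_congr rfl fun A hA => ?_
  have hP' := fun hCA => hP A hCA (mem_Fam.1 hA).1
  by_cases hPA : P A
  · rw [if_pos hPA, if_pos hPA, hΨ A hA hPA]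
    congr 1
    split_ifs with h1 h2
    · rfl
    · exact absurd ((hP' h1).2 hPA) h2
    · rfl
  · rw [if_neg hPA, if_neg hPA, zero_add]
    split_ifs with h1 h2
    · exact absurd ((hP' h1).1 h2) hPA
    · rfl
    · rfl

/-- If `C ⊆ A`, then `insert v A` weighs `∏ w u` times as much as `A`, so the factor `1 + ∏ w u` on
`C` accounts for both sets at once. -/
theorem IsStep.wt_absorb (h : IsStep k G S v C) (w : Finset V → ℝ) {A : Finset V}
    (hA : A ⊆ S) :
    wt k G (absorb v C w) A = wt k G w A + if C ⊆ A then wt k G w (insert v A) else 0 := by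
  rw [absorb, wt_update h.clique]
  split_ifs with hCA
  · rw [(h.mono hA hCA).wt_insert]; ring
  · ring

theorem IsStep.sum_filter_wt (h : IsStep k G S v C) (P : Finset V → Prop)
    [DecidablePred P] (hP : ∀ A, C ⊆ A → A ⊆ S → (P (insert v A) ↔ P A)) (w : Finset V → ℝ) :
    ∑ A ∈ (Fam k G (insert v S)).filter P, wt k G w A =
      ∑ A ∈ (Fam k G S).filter P, wt k G (absorb v C w) A + ∑ u ∈ (newCl v C).filter P, w u := by
  rw [h.sum_filter_Fam_insert P hP (wt k G w) (wt k G (absorb v C w))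
    (fun A hA _ => h.wt_absorb w (mem_Fam.1 hA).1)]
  congr 1
  exact Finset.sum_congr rfl fun u hu =>
    wt_clique (h.isNClique_of_mem_newCl (Finset.mem_filter.1 hu).1) w

/-- No new `k`-clique contains an old one. -/
theorem IsStep.not_subset_new (h : IsStep k G S v C) {q u : Finset V} (hq : q ⊆ S)
    (hk : k ≤ q.card) (hu : u ∈ newCl v C) : ¬ q ⊆ u := by
  intro hqu
  have hv : v ∉ q := fun hv => h.notMem (hq hv)
  have h1 := Finset.card_le_card (Finset.subset_erase.2 ⟨hqu, hv⟩)
  rw [Finset.card_erase_of_mem (self_mem_of_mem_newCl hu),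
    (h.isNClique_of_mem_newCl hu).card_eq] at h1
  have h2 : 0 < u.card := Finset.card_pos.2 ⟨v, self_mem_of_mem_newCl hu⟩
  rw [(h.isNClique_of_mem_newCl hu).card_eq] at h2
  omega

theorem subset_insert_iff_of_subset {q A : Finset V} (hv : v ∉ S) (hq : q ⊆ S) :
    q ⊆ insert v A ↔ q ⊆ A :=
  Finset.subset_insert_iff_of_notMem fun h => hv (hq h)

end Step

/-! ### The local mean -/

/-- The data accumulated at a `k`-clique: the number `w` of ways to extend a sub-`k`-tree beyond
it, the mean number `s` of vertices of such an extension, the number `m` of vertices beyond it and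
the number `h` of branches. -/
structure Inv (w s : ℝ) (m h : ℕ) : Prop where
  one_le : 1 ≤ w
  pow_le : 2 ^ (m + h) ≤ w ^ 2
  mean : (m : ℝ) / 2 + (if m = h then 0 else 1 / 10) ≤ s
  le : h ≤ m
  zero : h = 0 → m = 0

theorem one_le_prod_real {ι : Type*} {U : Finset ι} {w : ι → ℝ} (h : ∀ u ∈ U, 1 ≤ w u) :
    1 ≤ ∏ u ∈ U, w u :=
  Finset.prod_induction w (1 ≤ ·) (fun _ _ ha hb => one_le_mul_of_one_le_of_one_le ha hb)
    le_rfl h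

/-- Squared form of 5M + 6 ≤ 4f when f² ≥ 2^(M+2). Equality at M = 2 is what limits the surplus in
`Inv` to 1/10. -/
theorem sq_le_pow_two {M : ℕ} (hM : 2 ≤ M) : (5 * (M : ℝ) + 6) ^ 2 ≤ 64 * 2 ^ M := by
  induction M, hM using Nat.le_induction with
  | base => norm_num
  | succ n hn ih =>
    have : (2 : ℝ) ≤ n := by exact_mod_cast hn
    rw [pow_succ (2 : ℝ) n]
    push_cast
    nlinarith

/-- A branch is absent (weight 1) or present (weight f), so it multiplies the weight by 1 + f and
adds f(1 + σ)/(1 + f) to the mean. A single vertex adds at least 1/2 because f ≥ 1. For a larger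
branch f is exponentially large in M, so absence is rare enough to gain 1/10. The condition `h u ≠
1` encodes the exclusion of degree 2: besides its `h u` branches, `u` lies in the `(k+1)`-clique of
the new vertex. -/
theorem Inv.merge {ι : Type*} {U : Finset ι} {w s : ι → ℝ} {m h : ι → ℕ} {w₀ s₀ : ℝ}
    {m₀ h₀ : ℕ} (h0 : Inv w₀ s₀ m₀ h₀) (hU : ∀ u ∈ U, Inv (w u) (s u) (m u) (h u))
    (hh : ∀ u ∈ U, h u ≠ 1) :
    Inv (w₀ * (1 + ∏ u ∈ U, w u))
      (s₀ + (∏ u ∈ U, w u) * (1 + ∑ u ∈ U, s u) / (1 + ∏ u ∈ U, w u))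
      (m₀ + (1 + ∑ u ∈ U, m u)) (h₀ + 1) := by
  set f := ∏ u ∈ U, w u with hf
  set M := ∑ u ∈ U, m u with hM
  set σ := ∑ u ∈ U, s u with hσ
  have hf1 : 1 ≤ f := one_le_prod_real fun u hu => (hU u hu).one_le
  have hσM : (M : ℝ) / 2 ≤ σ := by
    rw [hM, Nat.cast_sum, Finset.sum_div]
    refine Finset.sum_le_sum fun u hu => le_trans ?_ (hU u hu).mean
    have : (0 : ℝ) ≤ if m u = h u then 0 else 1 / 10 := by split_ifs <;> norm_num
    linarith
  have hMh : ∑ u ∈ U, h u ≤ M := Finset.sum_le_sum fun u hu => (hU u hu).le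
  -- A nonzero `h u` is at least 2, which supplies the extra 2 in the exponent.
  have hcase : M = 0 ∨ 2 ≤ M ∧ (2 : ℝ) ^ (M + 2) ≤ f ^ 2 := by
    by_cases hall : ∀ u ∈ U, h u = 0
    · exact Or.inl (Finset.sum_eq_zero fun u hu => (hU u hu).zero (hall u hu))
    · right
      push Not at hall
      obtain ⟨u, hu, hne⟩ := hall
      have h2 : 2 ≤ ∑ u ∈ U, h u :=
        le_trans (by have := hh u hu; omega)
          (Finset.single_le_sum (f := h) (fun _ _ => Nat.zero_le _) hu)
      refine ⟨h2.trans hMh, ?_⟩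
      calc (2 : ℝ) ^ (M + 2) ≤ 2 ^ (∑ u ∈ U, (m u + h u)) := by
            refine pow_le_pow_right₀ (by norm_num) ?_
            rw [Finset.sum_add_distrib]; omega
        _ = ∏ u ∈ U, 2 ^ (m u + h u) := (Finset.prod_pow_eq_pow_sum _ _ _).symm
        _ ≤ ∏ u ∈ U, w u ^ 2 := Finset.prod_le_prod (fun _ _ => by positivity)
            fun u hu => (hU u hu).pow_le
        _ = f ^ 2 := by rw [Finset.prod_pow]
  have hpow : (2 : ℝ) ^ (M + 2) ≤ (1 + f) ^ 2 := by
    rcases hcase with h | ⟨_, h⟩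
    · rw [h, zero_add]; nlinarith
    · nlinarith
  refine ⟨?_, ?_, ?_, ?_, by omega⟩
  · nlinarith [h0.one_le]
  · calc (2 : ℝ) ^ (m₀ + (1 + M) + (h₀ + 1)) = 2 ^ (m₀ + h₀) * 2 ^ (M + 2) := by
          rw [← pow_add]; congr 1; ring
      _ ≤ w₀ ^ 2 * (1 + f) ^ 2 := by
          gcongr
          exact h0.pow_le
      _ = _ := by ring
  · have hb : (1 + M : ℝ) / 2 + (if M = 0 then 0 else 1 / 10) ≤ f * (1 + σ) / (1 + f) := by
      rw [le_div_iff₀ (by linarith)]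
      rcases hcase with h | ⟨h2, h⟩
      · rw [if_pos h]
        rw [h] at hσM ⊢
        simp only [Nat.cast_zero] at hσM ⊢
        nlinarith
      · rw [if_neg (by omega)]
        have h3 := sq_le_pow_two h2
        rw [pow_add] at h
        -- With σ ≥ M/2, the desired f(1 + σ) ≥ (1 + f)((1 + M)/2 + 1/10) follows from exactly this.
        have h4 : (5 * (M : ℝ) + 6) ≤ 4 * f := by
          refine abs_le_of_sq_le_sq' ?_ (by linarith) |>.2
          nlinarith
        nlinarith [mul_le_mul_of_nonneg_left hσM (by linarith : 0 ≤ f)]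
    have h1 := h0.mean
    -- The total differs from the number of branches only if the old data already did or the new
    -- branch has more than one vertex, so one of the two surpluses is available.
    have h2 : (if m₀ + (1 + M) = h₀ + 1 then (0 : ℝ) else 1 / 10) ≤
        (if m₀ = h₀ then 0 else 1 / 10) + (if M = 0 then 0 else 1 / 10) := by
      have := h0.le
      split_ifs <;> first | omega | norm_num
    push_cast
    linarith
  · have := h0.le
    omega

/-- The number of vertices of `A` outside a `k`-clique, with additional contributions. -/
noncomputable def size (k : ℕ) (G : SimpleGraph V) (s : Finset V → ℝ) (A : Finset V) : ℝ :=
  (A.card : ℝ) - k + ∑ q ∈ Cl k G A, s q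

/-- The increment of `s C` is the weighted mean size of the branch: `v` is present with probability
f/(1 + f), and then 1 + ∑ s vertices are gained, where f = ∏ w. -/
theorem IsStep.wt_mul_size_absorb {S C : Finset V} {v : V} (h : IsStep k G S v C)
    (w s : Finset V → ℝ) (hw : 1 + ∏ u ∈ newCl v C, w u ≠ 0) {A : Finset V} (hA : A ⊆ S) :
    wt k G (absorb v C w) A * size k G (Function.update s C (s C + (∏ u ∈ newCl v C, w u) *
        (1 + ∑ u ∈ newCl v C, s u) / (1 + ∏ u ∈ newCl v C, w u))) A =
      wt k G w A * size k G s A +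
        if C ⊆ A then wt k G w (insert v A) * size k G s (insert v A) else 0 := by
  rw [absorb, wt_update h.clique, size, size, size, sum_update_Cl h.clique]
  split_ifs with hCA
  · have h' := h.mono hA hCA
    rw [h'.wt_insert, h'.sum_Cl_insert, Finset.card_insert_of_notMem h'.notMem]
    push_cast
    field_simp
    ring
  · ring

/-- Peeling towards `c` turns the whole tree into data at `c`, with `Inv` preserved by `Inv.merge`.
Absorbing `v` into `C` moves one unit from the degree of `C` to `h C`, so `h q + deg q` is invariant
and the hypothesis on it survives. The root is exempt from that hypothesis. -/
theorem exists_inv {S c : Finset V} (hS : KT k G S) (hc : c ∈ Cl k G S) :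
    ∀ (w s : Finset V → ℝ) (m h : Finset V → ℕ),
      (∀ q ∈ Cl k G S, Inv (w q) (s q) (m q) (h q)) →
      (∀ q ∈ Cl k G S, q ≠ c → h q + deg k G S q ≠ 2) →
      ∃ x y, ∑ A ∈ (Fam k G S).filter (c ⊆ ·), wt k G w A = x ∧
        ∑ A ∈ (Fam k G S).filter (c ⊆ ·), wt k G w A * size k G s A = x * y ∧
        Inv x y (∑ q ∈ Cl k G S, m q + (S.card - k)) (h c + deg k G S c) := by
  obtain ⟨hcS, hcl⟩ := mem_Cl.1 hc
  clear hc
  refine (KT.base c hcl).grow_induction (motive := fun S => ∀ (w s : Finset V → ℝ)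
    (m h : Finset V → ℕ), (∀ q ∈ Cl k G S, Inv (w q) (s q) (m q) (h q)) →
      (∀ q ∈ Cl k G S, q ≠ c → h q + deg k G S q ≠ 2) →
      ∃ x y, ∑ A ∈ (Fam k G S).filter (c ⊆ ·), wt k G w A = x ∧
        ∑ A ∈ (Fam k G S).filter (c ⊆ ·), wt k G w A * size k G s A = x * y ∧
        Inv x y (∑ q ∈ Cl k G S, m q + (S.card - k)) (h c + deg k G S c)) ?_ ?_ hS hcS
  · intro w s m h hI _
    refine ⟨w c, s c, ?_, ?_, ?_⟩
    · simp [Fam_self hcl, Finset.filter_singleton, wt_clique hcl]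
    · simp [Fam_self hcl, Finset.filter_singleton, wt_clique hcl, size, Cl_self hcl, hcl.card_eq]
    · rw [Cl_self hcl, deg_self hcl, hcl.card_eq] at *
      simpa using hI
  · intro S v C hS hcS hst ih w s m h hI hd
    have hClS : ∀ q ∈ Cl k G S, q ∈ Cl k G (insert v S) := fun q hq => by
      rw [hst.Cl_insert]; exact Finset.mem_union_left _ hq
    have hClN : ∀ q ∈ newCl v C, q ∈ Cl k G (insert v S) := fun q hq => by
      rw [hst.Cl_insert]; exact Finset.mem_union_right _ hq
    have hIN : ∀ u ∈ newCl v C, Inv (w u) (s u) (m u) (h u) := fun u hu => hI u (hClN u hu)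
    have hcN : c ∉ newCl v C := fun hm => hst.notMem (hcS (self_mem_of_mem_newCl hm))
    have hmerge := (hI C (hClS C hst.mem_Cl)).merge hIN (fun u hu => by
      have := hd u (hClN u hu) (fun e => hcN (e ▸ hu))
      rw [hst.deg_insert_new hu] at this
      omega)
    have hf1 : (1 : ℝ) ≤ ∏ u ∈ newCl v C, w u := one_le_prod_real fun u hu => (hIN u hu).one_le
    obtain ⟨x, y, hx, hy, hxy⟩ := ih (absorb v C w)
      (Function.update s C (s C + (∏ u ∈ newCl v C, w u) *
        (1 + ∑ u ∈ newCl v C, s u) / (1 + ∏ u ∈ newCl v C, w u)))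
      (Function.update m C (m C + (1 + ∑ u ∈ newCl v C, m u)))
      (Function.update h C (h C + 1))
      (by
        intro q hq
        by_cases hqC : q = C
        · subst hqC
          simpa [absorb] using hmerge
        · simpa [absorb, hqC] using hI q (hClS q hq))
      (by
        intro q hq hqc
        have h1 := hd q (hClS q hq) hqc
        by_cases hqC : q = C
        · subst hqC
          rw [hst.deg_insert_self] at h1
          rw [Function.update_self]
          omega
        · rw [hst.deg_insert_of_ne hq hqC] at h1
          rwa [Function.update_of_ne hqC])
    have hP : ∀ A, C ⊆ A → A ⊆ S → (c ⊆ insert v A ↔ c ⊆ A) := fun A _ _ =>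
      subset_insert_iff_of_subset hst.notMem hcS
    have hempty : (newCl v C).filter (c ⊆ ·) = ∅ := Finset.filter_eq_empty_iff.2 fun u hu =>
      hst.not_subset_new hcS hcl.card_eq.ge hu
    refine ⟨x, y, ?_, ?_, ?_⟩
    · rw [hst.sum_filter_wt _ hP, hempty, Finset.sum_empty, add_zero, hx]
    · rw [hst.sum_filter_Fam_insert _ hP _ _
        (fun A hA _ => hst.wt_mul_size_absorb w s (by positivity) (mem_Fam.1 hA).1), hempty,
        Finset.sum_empty, add_zero, hy]
    · rw [sum_update_Cl hst.clique, if_pos hst.subset] at hxy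
      rw [hst.sum_Cl_insert, Finset.card_insert_of_notMem hst.notMem]
      have hk := hS.card_le
      have e1 : ∑ q ∈ Cl k G S, m q + (1 + ∑ u ∈ newCl v C, m u) + (S.card - k) =
          ∑ q ∈ Cl k G S, m q + ∑ u ∈ newCl v C, m u + (S.card + 1 - k) := by omega
      have e2 : Function.update h C (h C + 1) c + deg k G S c =
          h c + deg k G (insert v S) c := by
        by_cases hcC : c = C
        · subst hcC
          rw [hst.deg_insert_self, Function.update_self]; ring
        · rw [hst.deg_insert_of_ne (SubKTree.mem_Cl.2 ⟨hcS, hcl⟩) hcC,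
            Function.update_of_ne hcC]
      rw [← e1, ← e2]
      exact hxy

end SubKTree

namespace SubKTree

variable {V : Type*} [DecidableEq V] {k : ℕ} {G : SimpleGraph V}

/-! ### Sub-`k`-trees that avoid a `k`-clique -/

theorem IsStep.one_le_absorb {S C : Finset V} {v : V} (hst : IsStep k G S v C)
    {w : Finset V → ℝ} (hw : ∀ q ∈ Cl k G (insert v S), 1 ≤ w q) :
    ∀ q ∈ Cl k G S, 1 ≤ absorb v C w q := by
  rw [hst.Cl_insert] at hw
  intro q hq
  have h1 := hw q (Finset.mem_union_left _ hq)
  have hf1 : (1 : ℝ) ≤ ∏ u ∈ newCl v C, w u :=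
    one_le_prod_real fun u hu => hw u (Finset.mem_union_right _ hu)
  by_cases hqC : q = C
  · subst hqC
    rw [absorb, Function.update_self]
    nlinarith
  · rwa [absorb, Function.update_of_ne hqC]

theorem sum_wt_one {F : Finset (Finset V)} :
    ∑ A ∈ F, wt k G (fun _ => 1) A = F.card := by
  simp [wt]

/-- Peeling down to the common `(k+1)`-clique `e` leaves only `u` alone, `c` alone, and `e`. The
weight of `e` is the product of all its clique weights, each at least 1, hence at least the product
of those of `u` and `c`. -/
theorem card_mul_card_le {S c u e : Finset V} (hS : KT k G S) (hc : G.IsNClique k c)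
    (hu : G.IsNClique k u) (he : G.IsNClique (k + 1) e) (heS : e ⊆ S) (hce : c ⊆ e) (hue : u ⊆ e)
    (hne : c ≠ u) :
    ((Fam k G S).filter fun A => u ⊆ A ∧ ¬ c ⊆ A).card *
      ((Fam k G S).filter fun A => c ⊆ A ∧ ¬ u ⊆ A).card ≤
      ((Fam k G S).filter fun A => c ⊆ A ∧ u ⊆ A).card := by
  have key : ∀ w : Finset V → ℝ, (∀ q ∈ Cl k G S, 1 ≤ w q) →
      (∑ A ∈ (Fam k G S).filter fun A => u ⊆ A ∧ ¬ c ⊆ A, wt k G w A) *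
        (∑ A ∈ (Fam k G S).filter fun A => c ⊆ A ∧ ¬ u ⊆ A, wt k G w A) ≤
        ∑ A ∈ (Fam k G S).filter fun A => c ⊆ A ∧ u ⊆ A, wt k G w A := by
    refine (KT.of_isNClique_succ he).grow_induction (motive := fun S =>
      ∀ w : Finset V → ℝ, (∀ q ∈ Cl k G S, 1 ≤ w q) →
      (∑ A ∈ (Fam k G S).filter fun A => u ⊆ A ∧ ¬ c ⊆ A, wt k G w A) *
        (∑ A ∈ (Fam k G S).filter fun A => c ⊆ A ∧ ¬ u ⊆ A, wt k G w A) ≤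
        ∑ A ∈ (Fam k G S).filter fun A => c ⊆ A ∧ u ⊆ A, wt k G w A) ?_ ?_ hS heS
    · intro w hw
      have hsing : ∀ a b : Finset V, G.IsNClique k a → a ⊆ e → b ⊆ e → a ≠ b → b.card = k →
          (Fam k G e).filter (fun A => a ⊆ A ∧ ¬ b ⊆ A) = {a} := by
        intro a b ha hae hbe hab hb
        ext A
        simp only [Finset.mem_filter, mem_Fam, Finset.mem_singleton]
        constructor
        · rintro ⟨⟨h1, h2⟩, h3, h4⟩
          have hle := Finset.card_le_card h1
          rw [he.card_eq] at hle
          have hAe : A.card ≠ k + 1 := fun hA => h4 (by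
            rwa [Finset.eq_of_subset_of_card_le h1 (by rw [hA, he.card_eq])])
          exact (Finset.eq_of_subset_of_card_le h3 (by rw [ha.card_eq]; omega)).symm
        · rintro rfl
          refine ⟨⟨hae, KT.base _ ha⟩, subset_rfl, fun h => hab ?_⟩
          exact (Finset.eq_of_subset_of_card_le h (by rw [ha.card_eq, hb])).symm
      rw [hsing u c hu hue hce hne.symm hc.card_eq, hsing c u hc hce hue hne hu.card_eq,
        Finset.sum_singleton, Finset.sum_singleton, wt_clique hu, wt_clique hc]
      have hpos : ∀ A ∈ (Fam k G e).filter (fun A => c ⊆ A ∧ u ⊆ A), 0 ≤ wt k G w A := by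
        intro A hA
        refine Finset.prod_nonneg fun q hq => zero_le_one.trans (hw q ?_)
        exact mem_Cl.2 ⟨(mem_Cl.1 hq).1.trans (mem_Fam.1 (Finset.mem_filter.1 hA).1).1,
          (mem_Cl.1 hq).2⟩
      refine le_trans ?_ (Finset.single_le_sum hpos (Finset.mem_filter.2
        ⟨mem_Fam.2 ⟨subset_rfl, KT.of_isNClique_succ he⟩, hce, hue⟩))
      have hmu : u ∈ Cl k G e := mem_Cl.2 ⟨hue, hu⟩
      have hmc : c ∈ (Cl k G e).erase u := Finset.mem_erase.2 ⟨hne, mem_Cl.2 ⟨hce, hc⟩⟩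
      rw [wt, ← Finset.mul_prod_erase _ _ hmu, ← Finset.mul_prod_erase _ _ hmc, ← mul_assoc]
      have h1 := hw u hmu
      have h2 := hw c (Finset.mem_of_mem_erase hmc)
      refine le_mul_of_one_le_right (by positivity) (one_le_prod_real fun q hq => hw q ?_)
      exact Finset.mem_of_mem_erase (Finset.mem_of_mem_erase hq)
    · intro S v C hS heS hst ih w hw
      have hcS := hce.trans heS
      have huS := hue.trans heS
      have hc' : ∀ A, c ⊆ insert v A ↔ c ⊆ A := fun A => subset_insert_iff_of_subset hst.notMem hcS
      have hu' : ∀ A, u ⊆ insert v A ↔ u ⊆ A := fun A => subset_insert_iff_of_subset hst.notMem huS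
      have hnc : ∀ q ∈ newCl v C, ¬ c ⊆ q := fun q hq =>
        hst.not_subset_new hcS hc.card_eq.ge hq
      have hnu : ∀ q ∈ newCl v C, ¬ u ⊆ q := fun q hq =>
        hst.not_subset_new huS hu.card_eq.ge hq
      rw [hst.sum_filter_wt _ (fun A _ _ => by rw [hc', hu']),
        hst.sum_filter_wt _ (fun A _ _ => by rw [hc', hu']),
        hst.sum_filter_wt _ (fun A _ _ => by rw [hc', hu']),
        Finset.filter_eq_empty_iff.2 fun q hq h => hnu q hq h.1,
        Finset.filter_eq_empty_iff.2 fun q hq h => hnc q hq h.1,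
        Finset.filter_eq_empty_iff.2 fun q hq h => hnc q hq h.1]
      simpa using ih _ (hst.one_le_absorb hw)
  have := key (fun _ => 1) (fun _ _ => le_rfl)
  rw [sum_wt_one, sum_wt_one, sum_wt_one] at this
  exact_mod_cast this

/-- There are k·m cliques other than `c`, where m is the number of vertices outside `c`. Under
peeling, a sub-`k`-tree avoiding `c` shrinks to one of these, whose weight counts it. Weights do not
decrease towards the root, so each is bounded by the weight of a clique sharing a `(k+1)`-clique
with `c`, hence by `B`. -/
theorem card_avoid_le {S c : Finset V} (hS : KT k G S) (hc : G.IsNClique k c) (hcS : c ⊆ S)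
    {B : ℝ} (hB : ∀ u ∈ Cl k G S, u ≠ c → (∃ e ∈ Cl (k + 1) G S, c ⊆ e ∧ u ⊆ e) →
      (((Fam k G S).filter fun A => u ⊆ A ∧ ¬ c ⊆ A).card : ℝ) ≤ B) :
    (((Fam k G S).filter fun A => ¬ c ⊆ A).card : ℝ) ≤ k * (S.card - k : ℕ) * B := by
  -- `g q` counts the sub-`k`-trees lost inside branches absorbed into `q`, and `m q` the vertices
  -- of these branches. The loss is bounded by the weight of `q` until it reaches `c`.
  have key : ∀ (w g : Finset V → ℝ) (m : Finset V → ℕ), (∀ q ∈ Cl k G S, 1 ≤ w q) →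
      (∀ q ∈ Cl k G S, q ≠ c → g q ≤ k * m q * w q) →
      (∀ u ∈ Cl k G S, u ≠ c → (∃ e ∈ Cl (k + 1) G S, c ⊆ e ∧ u ⊆ e) →
        ∑ A ∈ (Fam k G S).filter (fun A => u ⊆ A ∧ ¬ c ⊆ A), wt k G w A ≤ B) →
      ∑ A ∈ (Fam k G S).filter (fun A => ¬ c ⊆ A), wt k G w A + ∑ q ∈ Cl k G S, g q ≤
        g c + k * (∑ q ∈ (Cl k G S).erase c, (m q : ℝ) + (S.card - k : ℝ)) * B := by
    refine (KT.base c hc).grow_induction (motive := fun S =>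
      ∀ (w g : Finset V → ℝ) (m : Finset V → ℕ), (∀ q ∈ Cl k G S, 1 ≤ w q) →
      (∀ q ∈ Cl k G S, q ≠ c → g q ≤ k * m q * w q) →
      (∀ u ∈ Cl k G S, u ≠ c → (∃ e ∈ Cl (k + 1) G S, c ⊆ e ∧ u ⊆ e) →
        ∑ A ∈ (Fam k G S).filter (fun A => u ⊆ A ∧ ¬ c ⊆ A), wt k G w A ≤ B) →
      ∑ A ∈ (Fam k G S).filter (fun A => ¬ c ⊆ A), wt k G w A + ∑ q ∈ Cl k G S, g q ≤
        g c + k * (∑ q ∈ (Cl k G S).erase c, (m q : ℝ) + (S.card - k : ℝ)) * B) ?_ ?_ hS hcS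
    · intro w g m _ _ _
      simp [Fam_self hc, Cl_self hc, Finset.filter_singleton, hc.card_eq]
    · intro S v C hS hcS hst ih w g m hw hg hB
      have hc' : ∀ A, c ⊆ insert v A ↔ c ⊆ A := fun A => subset_insert_iff_of_subset hst.notMem hcS
      have hnc : ∀ q ∈ newCl v C, ¬ c ⊆ q := fun q hq =>
        hst.not_subset_new hcS hc.card_eq.ge hq
      have hClS : ∀ q ∈ Cl k G S, q ∈ Cl k G (insert v S) := fun q hq => by
        rw [hst.Cl_insert]; exact Finset.mem_union_left _ hq
      have hClN : ∀ q ∈ newCl v C, q ∈ Cl k G (insert v S) := fun q hq => by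
        rw [hst.Cl_insert]; exact Finset.mem_union_right _ hq
      have hcN : ∀ q ∈ newCl v C, q ≠ c := fun q hq e => hnc q hq (e ▸ subset_rfl)
      have hw1 : ∀ u ∈ newCl v C, 1 ≤ w u := fun u hu => hw u (hClN u hu)
      have hf1 : (1 : ℝ) ≤ ∏ u ∈ newCl v C, w u := one_le_prod_real hw1
      -- Absorption away from `c` may replace each `w u` by the full product, which the new weight
      -- of `C` dominates.
      have hwf : ∀ u ∈ newCl v C, w u ≤ ∏ u ∈ newCl v C, w u := fun u hu => by
        rw [← Finset.mul_prod_erase _ _ hu]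
        exact le_mul_of_one_le_right (zero_le_one.trans (hw1 u hu))
          (one_le_prod_real fun q hq => hw1 q (Finset.mem_of_mem_erase hq))
      have hgw : ∀ u ∈ newCl v C, g u + w u ≤ (k * m u + 1) * w u := fun u hu => by
        linarith [hg u (hClN u hu) (hcN u hu)]
      have hcard : (((newCl v C).card : ℕ) : ℝ) = k := by rw [hst.card_newCl]
      -- the bound for the cliques absorbed into `C`
      have habs : ∀ D : ℝ, (∀ u ∈ newCl v C, w u ≤ D) →
          ∑ u ∈ newCl v C, (g u + w u) ≤ k * (1 + ∑ u ∈ newCl v C, (m u : ℝ)) * D := by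
        intro D hD
        calc ∑ u ∈ newCl v C, (g u + w u) ≤ ∑ u ∈ newCl v C, (k * m u + 1) * D :=
              Finset.sum_le_sum fun u hu => (hgw u hu).trans
                (mul_le_mul_of_nonneg_left (hD u hu) (by positivity))
          _ = k * (1 + ∑ u ∈ newCl v C, (m u : ℝ)) * D := by
              rw [← Finset.sum_mul, Finset.sum_add_distrib, ← Finset.mul_sum, Finset.sum_const,
                nsmul_eq_mul, hcard]
              ring
      have hih := ih (absorb v C w)
        (Function.update g C (g C + ∑ u ∈ newCl v C, (g u + w u)))
        (Function.update m C (m C + (1 + ∑ u ∈ newCl v C, m u)))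
        (hst.one_le_absorb hw) ?_ ?_
      · rw [sum_update_Cl hst.clique, if_pos hst.subset] at hih
        rw [hst.sum_filter_wt _ (fun A _ _ => by rw [hc']), Finset.filter_true_of_mem hnc,
          hst.sum_Cl_insert, Finset.card_insert_of_notMem hst.notMem]
        have hErase : ∑ q ∈ (Cl k G (insert v S)).erase c, (m q : ℝ) =
            ∑ q ∈ (Cl k G S).erase c, (m q : ℝ) + ∑ u ∈ newCl v C, (m u : ℝ) := by
          have hcS' : c ∈ Cl k G S := mem_Cl.2 ⟨hcS, hc⟩
          have h1 := Finset.add_sum_erase _ (fun q => (m q : ℝ)) (hClS c hcS')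
          have h2 := Finset.add_sum_erase _ (fun q => (m q : ℝ)) hcS'
          have h3 := hst.sum_Cl_insert (fun q => (m q : ℝ))
          linarith
        rw [hErase]
        rw [Finset.sum_add_distrib] at hih
        push_cast
        by_cases hcC : c = C
        · subst hcC
          -- `u` is itself a sub-`k`-tree containing `u` but not `c`, so its weight is one term of
          -- the sum bounded by `B`.
          have hBw : ∀ u ∈ newCl v c, w u ≤ B := by
            intro u hu
            refine le_trans ?_ (hB u (hClN u hu) (hcN u hu) ⟨insert v c, mem_Cl.2
              ⟨Finset.insert_subset_insert _ hcS, hst.isNClique_insert⟩,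
              Finset.subset_insert _ _, IsStep.subset_insert_of_mem_newCl hu⟩)
            have hcl := hst.isNClique_of_mem_newCl hu
            rw [← wt_clique hcl w]
            refine Finset.single_le_sum (f := wt k G w) ?_ (Finset.mem_filter.2
              ⟨mem_Fam.2 ⟨(mem_Cl.1 (hClN u hu)).1, KT.base _ hcl⟩, subset_rfl, hnc u hu⟩)
            intro A hA
            refine Finset.prod_nonneg fun q hq => zero_le_one.trans (hw q ?_)
            exact mem_Cl.2 ⟨(mem_Cl.1 hq).1.trans (mem_Fam.1 (Finset.mem_filter.1 hA).1).1,
              (mem_Cl.1 hq).2⟩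
          have hX := habs B hBw
          rw [Finset.sum_add_distrib] at hX
          have hM : ∑ q ∈ (Cl k G S).erase c,
              ((Function.update m c (m c + (1 + ∑ u ∈ newCl v c, m u)) q : ℕ) : ℝ) =
              ∑ q ∈ (Cl k G S).erase c, (m q : ℝ) := Finset.sum_congr rfl
            fun q hq => by rw [Function.update_of_ne (Finset.ne_of_mem_erase hq)]
          rw [Function.update_self, hM] at hih
          linarith
        · have hM : ∑ q ∈ (Cl k G S).erase c,
              ((Function.update m C (m C + (1 + ∑ u ∈ newCl v C, m u)) q : ℕ) : ℝ) =
              ∑ q ∈ (Cl k G S).erase c, (m q : ℝ) + (1 + ∑ u ∈ newCl v C, (m u : ℝ)) := by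
            have hm : C ∈ (Cl k G S).erase c := Finset.mem_erase.2 ⟨Ne.symm hcC, hst.mem_Cl⟩
            rw [← Finset.add_sum_erase _ _ hm, ← Finset.add_sum_erase _ (fun q => (m q : ℝ)) hm,
              Function.update_self, Finset.sum_congr rfl (g := fun q => (m q : ℝ))
                fun q hq => by rw [Function.update_of_ne (Finset.ne_of_mem_erase hq)]]
            push_cast
            ring
          rw [hM, Function.update_of_ne hcC] at hih
          linarith
      · intro q hq hqc
        by_cases hqC : q = C
        · subst hqC
          rw [absorb, Function.update_self, Function.update_self, Function.update_self]
          push_cast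
          have h1 := hg q (hClS q hq) hqc
          have h2 := habs _ hwf
          have h3 := hw q (hClS q hq)
          have h4 : (0 : ℝ) ≤ ∑ u ∈ newCl v q, (m u : ℝ) := by positivity
          have h5 : (k : ℝ) * m q * w q ≤
              k * m q * (w q * (1 + ∏ u ∈ newCl v q, w u)) := by
            gcongr
            nlinarith
          have h6 : k * (1 + ∑ u ∈ newCl v q, (m u : ℝ)) * ∏ u ∈ newCl v q, w u ≤
              k * (1 + ∑ u ∈ newCl v q, (m u : ℝ)) * (w q * (1 + ∏ u ∈ newCl v q, w u)) := by
            gcongr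
            nlinarith
          linarith
        · rw [absorb, Function.update_of_ne hqC, Function.update_of_ne hqC,
            Function.update_of_ne hqC]
          exact hg q (hClS q hq) hqc
      · intro u hu huc ⟨e, he, hce, hue⟩
        have huS := (mem_Cl.1 hu).1
        have hu' : ∀ A, u ⊆ insert v A ↔ u ⊆ A :=
          fun A => subset_insert_iff_of_subset hst.notMem huS
        have := hB u (hClS u hu) huc ⟨e, mem_Cl.2
          ⟨(mem_Cl.1 he).1.trans (Finset.subset_insert _ _), (mem_Cl.1 he).2⟩, hce, hue⟩
        rw [hst.sum_filter_wt _ (fun A _ _ => by rw [hc', hu']),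
          Finset.filter_eq_empty_iff.2 fun q hq h =>
            hst.not_subset_new huS (mem_Cl.1 hu).2.card_eq.ge hq h.1] at this
        simpa using this
  have := key (fun _ => 1) (fun _ => 0) (fun _ => 0) (fun _ _ => le_rfl) (fun _ _ _ => by simp)
    (fun u hu hne he => by rw [sum_wt_one]; exact hB u hu hne he)
  rw [sum_wt_one] at this
  simpa [Nat.cast_sub hS.card_le] using this

/-! ### Leaves -/

open Classical in
/-- The vertices of degree `k` in `S` outside `c` whose `k`-cliques `q` satisfy `h q = 0`. -/
noncomputable def leaves (k : ℕ) (G : SimpleGraph V) (c S : Finset V) (h : Finset V → ℕ) :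
    Finset V :=
  (S \ c).filter fun x => (S.filter (G.Adj x)).card = k ∧ ∀ q ∈ Cl k G S, x ∈ q → h q = 0

/-- With zero data this says that the number of vertices outside `c` plus the degree of `c` is at
most twice the number of leaves. `m`, `h` and `l` record the absorbed vertices, branches and leaves
at a clique. A one-vertex branch gives 1 + 1 ≤ 2; in a larger branch some clique has `h ≥ 2`, which
pays for the new vertex and the new branch. -/
theorem le_two_mul_card_leaves {S c : Finset V} (hS : KT k G S) (hc : G.IsNClique k c)
    (hcS : c ⊆ S) : ∀ m h l : Finset V → ℕ,
      (∀ q ∈ Cl k G S, m q + h q ≤ 2 * l q ∧ h q ≤ m q ∧ (h q = 0 → m q = 0)) →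
      (∀ q ∈ Cl k G S, q ≠ c → h q + deg k G S q ≠ 2) →
      ∑ q ∈ Cl k G S, m q + (S.card - k) + (h c + deg k G S c) ≤
        2 * ((leaves k G c S h).card + ∑ q ∈ Cl k G S, l q) := by
  classical
  refine (KT.base c hc).grow_induction (motive := fun S => ∀ m h l : Finset V → ℕ,
      (∀ q ∈ Cl k G S, m q + h q ≤ 2 * l q ∧ h q ≤ m q ∧ (h q = 0 → m q = 0)) →
      (∀ q ∈ Cl k G S, q ≠ c → h q + deg k G S q ≠ 2) →
      ∑ q ∈ Cl k G S, m q + (S.card - k) + (h c + deg k G S c) ≤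
        2 * ((leaves k G c S h).card + ∑ q ∈ Cl k G S, l q)) ?_ ?_ hS hcS
  · intro m h l hI _
    have := (hI c (by simp [Cl_self hc])).1
    simp only [Cl_self hc, deg_self hc, hc.card_eq, Finset.sum_singleton]
    omega
  · intro S v C hS hcS hst ih m h l hI hd
    have hClS : ∀ q ∈ Cl k G S, q ∈ Cl k G (insert v S) := fun q hq => by
      rw [hst.Cl_insert]; exact Finset.mem_union_left _ hq
    have hClN : ∀ q ∈ newCl v C, q ∈ Cl k G (insert v S) := fun q hq => by
      rw [hst.Cl_insert]; exact Finset.mem_union_right _ hq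
    have hcN : c ∉ newCl v C := fun hm => hst.notMem (hcS (self_mem_of_mem_newCl hm))
    have hh : ∀ u ∈ newCl v C, h u ≠ 1 := fun u hu => by
      have := hd u (hClN u hu) (fun e => hcN (e ▸ hu))
      rw [hst.deg_insert_new hu] at this
      omega
    -- The contribution of `v` itself, which is a leaf if nothing hangs on its new cliques.
    set t : ℕ := if ∀ u ∈ newCl v C, h u = 0 then 1 else 0 with ht
    have hleaf : (leaves k G c S (Function.update h C (h C + 1))).card + t ≤
        (leaves k G c (insert v S) h).card := by
      have hsub : leaves k G c S (Function.update h C (h C + 1)) ⊆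
          leaves k G c (insert v S) h := by
        intro x hx
        simp only [leaves, Finset.mem_filter, Finset.mem_sdiff] at hx ⊢
        obtain ⟨⟨hxS, hxc⟩, hxk, hxq⟩ := hx
        have hxC : x ∉ C := fun hxC => by
          have := hxq C hst.mem_Cl hxC
          simp at this
        have hxv : ¬ G.Adj x v := fun ha => hxC ((hst.adj x hxS).1 ha.symm)
        refine ⟨⟨Finset.mem_insert_of_mem hxS, hxc⟩, ?_, ?_⟩
        · rwa [Finset.filter_insert, if_neg hxv]
        · intro q hq hxq'
          rw [hst.Cl_insert] at hq
          rcases Finset.mem_union.1 hq with hq | hq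
          · have := hxq q hq hxq'
            rwa [Function.update_of_ne] at this
            rintro rfl
            exact hxC hxq'
          · rcases Finset.mem_insert.1 (IsStep.subset_insert_of_mem_newCl hq hxq') with e | e
            · exact absurd (e ▸ hxS) hst.notMem
            · exact absurd e hxC
      by_cases hall : ∀ u ∈ newCl v C, h u = 0
      · rw [ht, if_pos hall]
        have hv1 : v ∉ leaves k G c S (Function.update h C (h C + 1)) := by
          simp [leaves, hst.notMem]
        rw [← Finset.card_insert_of_notMem hv1]
        refine Finset.card_le_card (Finset.insert_subset ?_ hsub)
        simp only [leaves, Finset.mem_filter, Finset.mem_sdiff]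
        refine ⟨⟨Finset.mem_insert_self _ _, fun hv => hst.notMem (hcS hv)⟩, ?_, ?_⟩
        · rw [← hst.clique.card_eq]
          congr 1
          ext w
          rw [Finset.mem_filter, Finset.mem_insert]
          constructor
          · rintro ⟨rfl | hw, ha⟩
            · exact absurd ha (G.loopless.irrefl _)
            · exact (hst.adj w hw).1 ha
          · exact fun hw => ⟨Or.inr (hst.subset hw), (hst.adj w (hst.subset hw)).2 hw⟩
        · intro q hq hvq
          exact hall q (hst.mem_newCl_of_clique (mem_Cl.1 hq).1 hvq (mem_Cl.1 hq).2)
      · rw [ht, if_neg hall]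
        exact Finset.card_le_card hsub
    have hM0 : ∑ u ∈ newCl v C, m u + 2 ≤ 2 * (t + ∑ u ∈ newCl v C, l u) := by
      by_cases hall : ∀ u ∈ newCl v C, h u = 0
      · rw [ht, if_pos hall, Finset.sum_eq_zero
          fun u hu => (hI u (hClN u hu)).2.2 (hall u hu)]
        omega
      · rw [ht, if_neg hall]
        push Not at hall
        obtain ⟨u, hu, hne⟩ := hall
        have h2 : 2 ≤ ∑ u ∈ newCl v C, h u := le_trans (by have := hh u hu; omega)
          (Finset.single_le_sum (f := h) (fun _ _ => Nat.zero_le _) hu)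
        have h3 : ∑ u ∈ newCl v C, (m u + h u) ≤ ∑ u ∈ newCl v C, 2 * l u :=
          Finset.sum_le_sum fun u hu => (hI u (hClN u hu)).1
        rw [Finset.sum_add_distrib, ← Finset.mul_sum] at h3
        omega
    have hih := ih (Function.update m C (m C + (1 + ∑ u ∈ newCl v C, m u)))
      (Function.update h C (h C + 1)) (Function.update l C (l C + (t + ∑ u ∈ newCl v C, l u)))
      (by
        intro q hq
        have := hI q (hClS q hq)
        by_cases hqC : q = C
        · subst hqC
          simp only [Function.update_self]
          omega
        · simpa only [Function.update_of_ne hqC] using this)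
      (by
        intro q hq hqc
        have h1 := hd q (hClS q hq) hqc
        by_cases hqC : q = C
        · subst hqC
          rw [hst.deg_insert_self] at h1
          rw [Function.update_self]
          omega
        · rw [hst.deg_insert_of_ne hq hqC] at h1
          rwa [Function.update_of_ne hqC])
    rw [sum_update_Cl hst.clique, sum_update_Cl hst.clique, if_pos hst.subset,
      if_pos hst.subset] at hih
    rw [hst.sum_Cl_insert, hst.sum_Cl_insert, Finset.card_insert_of_notMem hst.notMem]
    have hk := hS.card_le
    have e2 : Function.update h C (h C + 1) c + deg k G S c =
        h c + deg k G (insert v S) c := by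
      by_cases hcC : c = C
      · subst hcC
        rw [hst.deg_insert_self, Function.update_self]; ring
      · rw [hst.deg_insert_of_ne (mem_Cl.2 ⟨hcS, hc⟩) hcC, Function.update_of_ne hcC]
    omega

theorem KT.exists_mem_Cl_succ {S : Finset V} (hS : KT k G S) :
    k < S.card → ∀ x ∈ S, ∃ e ∈ Cl (k + 1) G S, x ∈ e := by
  induction hS with
  | base C h => intro hk; have := h.card_eq; omega
  | step S v C hS hst ih =>
    intro _ x hx
    have hself : insert v C ∈ Cl (k + 1) G (insert v S) := by
      rw [hst.Cl_succ_insert]; exact Finset.mem_insert_self _ _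
    rcases Finset.mem_insert.1 hx with rfl | hx
    · exact ⟨_, hself, Finset.mem_insert_self _ _⟩
    · rcases hS.card_le.lt_or_eq with hlt | heq
      · obtain ⟨e, he, hxe⟩ := ih hlt x hx
        exact ⟨e, by rw [hst.Cl_succ_insert]; exact Finset.mem_insert_of_mem he, hxe⟩
      · have : C = S := Finset.eq_of_subset_of_card_le hst.subset
          (by rw [← heq, hst.clique.card_eq])
        subst this
        exact ⟨_, hself, Finset.mem_insert_of_mem hx⟩

open Classical in
/-- A vertex of degree `k` can be removed. -/
theorem KT.isStep_erase {S : Finset V} (hS : KT k G S) (hk : k < S.card) {x : V} (hx : x ∈ S)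
    (hd : (S.filter (G.Adj x)).card = k) :
    KT k G (S.erase x) ∧ IsStep k G (S.erase x) x (S.filter (G.Adj x)) := by
  obtain ⟨e, he, hxe⟩ := hS.exists_mem_Cl_succ hk x hx
  obtain ⟨heS, hec⟩ := mem_Cl.1 he
  have hsub : e.erase x ⊆ S.filter (G.Adj x) := fun w hw => Finset.mem_filter.2
    ⟨heS (Finset.mem_of_mem_erase hw), hec.isClique (by exact_mod_cast hxe)
      (by exact_mod_cast Finset.mem_of_mem_erase hw) (Finset.ne_of_mem_erase hw).symm⟩
  have hcard : (e.erase x).card = k := by rw [Finset.card_erase_of_mem hxe, hec.card_eq]; rfl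
  have heq := Finset.eq_of_subset_of_card_le hsub (by rw [hd, hcard])
  have hcl : G.IsNClique k (S.filter (G.Adj x)) :=
    ⟨heq ▸ hec.isClique.subset (by exact_mod_cast Finset.erase_subset _ _), hd⟩
  refine ⟨(hS.remove hx hd (fun w hw ha => Finset.mem_filter.2 ⟨hw, ha⟩) hk).2,
    Finset.notMem_erase _ _, ?_, hcl, ?_⟩
  · intro w hw
    obtain ⟨h1, h2⟩ := Finset.mem_filter.1 hw
    exact Finset.mem_erase.2 ⟨h2.ne', h1⟩
  · intro w hw
    rw [Finset.mem_filter]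
    exact ⟨fun ha => ⟨Finset.mem_of_mem_erase hw, ha⟩, fun h => h.2⟩

/-! ### The upper bound -/

/-- Removing `v` maps the sub-`k`-trees containing `insert v C` injectively to sub-`k`-trees of `S`.
The k new cliques contain neither `insert v C` nor lie in `S`; as k ≥ 1, this gives the extra 1 and
later the strict inequality. -/
theorem IsStep.two_mul_card_filter (hk : 1 ≤ k) {S C : Finset V} {v : V}
    (h : IsStep k G S v C) :
    2 * ((Fam k G (insert v S)).filter (insert v C ⊆ ·)).card + 1 ≤
      (Fam k G (insert v S)).card := by
  have h1 := h.sum_Fam_insert (fun _ => 1)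
  have h2 := h.sum_Fam_insert (fun A => if insert v C ⊆ A then 1 else 0)
  rw [← Finset.card_filter] at h2
  have h3 : ∑ u ∈ newCl v C, (if insert v C ⊆ u then 1 else 0) = 0 :=
    Finset.sum_eq_zero fun u hu => if_neg fun hs => by
      have := Finset.card_le_card hs
      rw [h.isNClique_insert.card_eq, (h.isNClique_of_mem_newCl hu).card_eq] at this
      omega
  have h4 : ∑ A ∈ Fam k G S, ((if insert v C ⊆ A then 1 else 0) +
      if C ⊆ A then if insert v C ⊆ insert v A then 1 else 0 else 0) ≤
      ∑ A ∈ Fam k G S, if C ⊆ A then 1 else 0 := by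
    refine Finset.sum_le_sum fun A hA => ?_
    have : ¬ insert v C ⊆ A := fun hs =>
      h.notMem ((mem_Fam.1 hA).1 (hs (Finset.mem_insert_self _ _)))
    rw [if_neg this, zero_add]
    split_ifs <;> simp
  have h5 : ∑ A ∈ Fam k G S, (if C ⊆ A then 1 else 0) ≤ ∑ A ∈ Fam k G S, 1 :=
    Finset.sum_le_sum fun A _ => by split_ifs <;> simp
  rw [Finset.sum_add_distrib, Finset.sum_const (s := newCl v C), h.card_newCl] at h1
  simp only [Finset.sum_const, smul_eq_mul, mul_one] at h1 h5
  rw [h3] at h2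
  omega

/-- The last vertex is joined to a clique `C` that already lay in a `(k+1)`-clique, so the degree of
`C` is at least 2, hence at least 3. -/
theorem KT.exists_three_le_deg {S : Finset V} (hS : KT k G S) (hk : k + 2 ≤ S.card)
    (hd : ∀ q ∈ Cl k G S, deg k G S q ≠ 2) : ∃ c ∈ Cl k G S, 3 ≤ deg k G S c := by
  cases hS with
  | base C h => rw [h.card_eq] at hk; omega
  | step S v C hS hst =>
    rw [Finset.card_insert_of_notMem hst.notMem] at hk
    have hC : C ∈ Cl k G (insert v S) := by
      rw [hst.Cl_insert]; exact Finset.mem_union_left _ hst.mem_Cl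
    refine ⟨C, hC, ?_⟩
    have h2 := hd C hC
    rw [hst.deg_insert_self] at h2 ⊢
    obtain ⟨x, hxS, hxC, hx⟩ := hS.exists_adj_clique hst.clique hst.subset
      (fun e => by rw [← e, hst.clique.card_eq] at hk; omega)
    have : 0 < deg k G S C := Finset.card_pos.2 ⟨insert x C, Finset.mem_filter.2
      ⟨mem_Cl.2 ⟨Finset.insert_subset hxS hst.subset, hst.clique.insert hx⟩,
        Finset.subset_insert _ _⟩⟩
    omega

/-- With L leaves, at most n - k - L `(k+1)`-cliques are not at a leaf, and each of the L others
occurs in fewer than half of the sub-`k`-trees. So the mean is below n - L/2, and a root of degree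
at least 3 gives 2L ≥ n - k + 3. -/
theorem sum_card_lt (hk : 1 ≤ k) {S : Finset V} (hS : KT k G S) (hk2 : k + 2 ≤ S.card)
    (hd : ∀ q ∈ Cl k G S, deg k G S q ≠ 2) :
    ∑ A ∈ Fam k G S, (A.card : ℝ) < (3 * (S.card : ℝ) + k - 3) / 4 * (Fam k G S).card := by
  classical
  obtain ⟨c, hc, hc3⟩ := hS.exists_three_le_deg hk2 hd
  obtain ⟨hcS, hcl⟩ := mem_Cl.1 hc
  have hL := le_two_mul_card_leaves hS hcl hcS (fun _ => 0) (fun _ => 0) (fun _ => 0)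
    (by simp) (by simpa using fun q hq _ => hd q hq)
  simp only [Finset.sum_const_zero, zero_add, add_zero] at hL
  set L := leaves k G c S (fun _ => 0) with hLdef
  let e : V → Finset V := fun x => insert x (S.filter (G.Adj x))
  have hLmem : ∀ x ∈ L, x ∈ S ∧ (S.filter (G.Adj x)).card = k := by
    intro x hx
    simp only [hLdef, leaves, Finset.mem_filter, Finset.mem_sdiff] at hx
    exact ⟨hx.1.1, hx.2.1⟩
  have hstep := fun x hx => hS.isStep_erase (by omega) (hLmem x hx).1 (hLmem x hx).2
  have hinj : Set.InjOn e L := by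
    intro x hx y hy hxy
    by_contra hne
    -- After deleting `x`, `y` still lies in a `(k+1)`-clique and so has k neighbours other than
    -- `x`. If `e x = e y`, then `x` is one more, against degree k.
    obtain ⟨hK, -⟩ := hstep x hx
    obtain ⟨hyS, hyk⟩ := hLmem y hy
    obtain ⟨b, hb, hyb⟩ := hK.exists_mem_Cl_succ
      (by rw [Finset.card_erase_of_mem (hLmem x hx).1]; omega) y
      (Finset.mem_erase.2 ⟨Ne.symm hne, hyS⟩)
    obtain ⟨hbS, hbc⟩ := mem_Cl.1 hb
    have hxb : x ∉ b := fun hxb => Finset.notMem_erase _ _ (hbS hxb)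
    have hsub : b.erase y ⊆ (S.filter (G.Adj y)).erase x := by
      intro w hw
      have hwb := Finset.mem_of_mem_erase hw
      refine Finset.mem_erase.2 ⟨fun h => hxb (h ▸ hwb), Finset.mem_filter.2
        ⟨Finset.mem_of_mem_erase (hbS hwb), hbc.isClique (by exact_mod_cast hyb)
          (by exact_mod_cast hwb) (Finset.ne_of_mem_erase hw).symm⟩⟩
    have hxy' : x ∈ S.filter (G.Adj y) := by
      have : x ∈ e y := hxy ▸ Finset.mem_insert_self _ _
      exact (Finset.mem_insert.1 this).resolve_left hne
    have := Finset.card_le_card hsub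
    rw [Finset.card_erase_of_mem hyb, Finset.card_erase_of_mem hxy', hbc.card_eq, hyk] at this
    omega
  have heCl : ∀ x ∈ L, e x ∈ Cl (k + 1) G S := fun x hx => by
    have := (hstep x hx).2.Cl_succ_insert
    rw [Finset.insert_erase (hLmem x hx).1] at this
    rw [this]
    exact Finset.mem_insert_self _ _
  have hCl := hS.card_Cl_succ
  have hLle : L.card ≤ S.card - k := by
    rw [← Finset.card_image_of_injOn hinj]
    have := Finset.card_le_card (Finset.image_subset_iff.2 heCl)
    omega
  -- the number of vertices of a sub-`k`-tree
  have hA : ∀ A ∈ Fam k G S,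
      A.card ≤ k + (S.card - k - L.card) + (L.filter (e · ⊆ A)).card := by
    intro A hA
    obtain ⟨hAS, hAK⟩ := mem_Fam.1 hA
    rw [← hAK.card_Cl_succ]
    have hsub : Cl (k + 1) G A ⊆ (Cl (k + 1) G S \ L.image e) ∪ (L.filter (e · ⊆ A)).image e := by
      intro q hq
      obtain ⟨h1, h2⟩ := mem_Cl.1 hq
      by_cases hqL : q ∈ L.image e
      · obtain ⟨x, hx, rfl⟩ := Finset.mem_image.1 hqL
        exact Finset.mem_union_right _ (Finset.mem_image_of_mem _ (Finset.mem_filter.2 ⟨hx, h1⟩))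
      · exact Finset.mem_union_left _ (Finset.mem_sdiff.2 ⟨mem_Cl.2 ⟨h1.trans hAS, h2⟩, hqL⟩)
    have h1 := (Finset.card_le_card hsub).trans (Finset.card_union_le _ _)
    rw [Finset.card_sdiff_of_subset (Finset.image_subset_iff.2 heCl),
      Finset.card_image_of_injOn hinj] at h1
    have h2 : ((L.filter (e · ⊆ A)).image e).card ≤ (L.filter (e · ⊆ A)).card :=
      Finset.card_image_le
    omega
  have hhalf : ∀ x ∈ L, 2 * ((Fam k G S).filter (e x ⊆ ·)).card + 1 ≤ (Fam k G S).card := by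
    intro x hx
    have := (hstep x hx).2.two_mul_card_filter hk
    rwa [Finset.insert_erase (hLmem x hx).1] at this
  have hsum : ∑ A ∈ Fam k G S, A.card ≤
      (Fam k G S).card * (S.card - L.card) + ∑ x ∈ L, ((Fam k G S).filter (e x ⊆ ·)).card := by
    have hcomm : ∑ x ∈ L, ((Fam k G S).filter (e x ⊆ ·)).card =
        ∑ A ∈ Fam k G S, (L.filter (e · ⊆ A)).card := by
      simp only [Finset.card_filter]
      exact Finset.sum_comm
    rw [hcomm, ← smul_eq_mul, ← Finset.sum_const, ← Finset.sum_add_distrib]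
    refine Finset.sum_le_sum fun A hA' => ?_
    have := hA A hA'
    omega
  have hsum2 : 2 * ∑ x ∈ L, ((Fam k G S).filter (e x ⊆ ·)).card + L.card ≤
      L.card * (Fam k G S).card := by
    rw [Finset.mul_sum, Finset.card_eq_sum_ones L, ← Finset.sum_add_distrib, Finset.sum_mul]
    exact Finset.sum_le_sum fun x hx => by rw [one_mul]; exact hhalf x hx
  have hLS : L.card ≤ S.card := hLle.trans (Nat.sub_le _ _)
  have hL' : (S.card : ℝ) - k + 3 ≤ 2 * L.card := by
    have : S.card + 3 ≤ 2 * L.card + k := by omega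
    have : ((S.card + 3 : ℕ) : ℝ) ≤ ((2 * L.card + k : ℕ) : ℝ) := by exact_mod_cast this
    push_cast at this
    linarith
  have hF : (0 : ℝ) ≤ (Fam k G S).card := by positivity
  have hL1 : (0 : ℝ) < L.card := by
    have : 0 < L.card := by omega
    exact_mod_cast this
  have h1 : (∑ A ∈ Fam k G S, (A.card : ℝ)) ≤ (Fam k G S).card * ((S.card : ℝ) - L.card) +
      ((∑ x ∈ L, ((Fam k G S).filter (e x ⊆ ·)).card : ℕ) : ℝ) := by
    rw [← Nat.cast_sub hLS]
    exact_mod_cast hsum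
  have h2 : 2 * ((∑ x ∈ L, ((Fam k G S).filter (e x ⊆ ·)).card : ℕ) : ℝ) + L.card ≤
      L.card * (Fam k G S).card := by exact_mod_cast hsum2
  nlinarith [mul_le_mul_of_nonneg_right hL' hF]

end SubKTree

namespace SubKTree

section State

variable {V : Type*} [DecidableEq V] {k : ℕ} {G : SimpleGraph V}

/-! ### Growing a `k`-tree at a current `k`-clique -/

/-- `S` is a `k`-tree in which every `k`-clique other than the current one `C` has degree `≠ 2`,
together with the degree `d` of `C`, the numbers `z` and `y` of sub-`k`-trees that contain `C` and
of all sub-`k`-trees, and the total numbers `r` and `ρ` of `(k + 1)`-cliques in them. -/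
structure State (k : ℕ) (G : SimpleGraph V) (S C : Finset V) (d z y r ρ : ℕ) : Prop where
  kt : KT k G S
  mem : C ∈ Cl k G S
  deg_ne : ∀ q ∈ Cl k G S, q ≠ C → deg k G S q ≠ 2
  deg_eq : deg k G S C = d
  card_through : ((Fam k G S).filter (C ⊆ ·)).card = z
  card_all : (Fam k G S).card = y
  sum_through : ∑ A ∈ (Fam k G S).filter (C ⊆ ·), (A.card - k) = r
  sum_all : ∑ A ∈ Fam k G S, (A.card - k) = ρ

theorem State.base {C : Finset V} (h : G.IsNClique k C) : State k G C C 0 1 1 0 0 where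
  kt := KT.base C h
  mem := mem_Cl.2 ⟨subset_rfl, h⟩
  deg_ne q _ _ := by rw [deg_self h]; omega
  deg_eq := deg_self h C
  card_through := by simp [Fam_self h, Finset.filter_singleton]
  card_all := by simp [Fam_self h]
  sum_through := by simp [Fam_self h, Finset.filter_singleton, h.card_eq]
  sum_all := by simp [Fam_self h, h.card_eq]

variable {S C : Finset V} {v : V}

theorem IsStep.card_Fam_insert (h : IsStep k G S v C) :
    (Fam k G (insert v S)).card =
      (Fam k G S).card + ((Fam k G S).filter (C ⊆ ·)).card + k := by
  have := h.sum_Fam_insert (fun _ => 1)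
  rw [Finset.sum_add_distrib, ← Finset.card_filter] at this
  simpa [h.card_newCl] using this

theorem IsStep.card_insert_sub (h : IsStep k G S v C) {A : Finset V} (hA : A ∈ Fam k G S) :
    (insert v A).card - k = (A.card - k) + 1 := by
  rw [Finset.card_insert_of_notMem fun hv => h.notMem ((mem_Fam.1 hA).1 hv)]
  have := (mem_Fam.1 hA).2.card_le
  omega

theorem IsStep.sum_card_Fam_insert (h : IsStep k G S v C) :
    ∑ A ∈ Fam k G (insert v S), (A.card - k) =
      ∑ A ∈ Fam k G S, (A.card - k) + ∑ A ∈ (Fam k G S).filter (C ⊆ ·), (A.card - k) +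
        ((Fam k G S).filter (C ⊆ ·)).card := by
  rw [h.sum_Fam_insert, Finset.sum_add_distrib, Finset.sum_eq_zero (s := newCl v C)
    fun u hu => by rw [(h.isNClique_of_mem_newCl hu).card_eq, Nat.sub_self],
    add_zero, ← Finset.sum_filter, add_assoc, Finset.sum_congr rfl
    fun A hA => h.card_insert_sub (Finset.mem_filter.1 hA).1, Finset.sum_add_distrib]
  simp

/-- The sub-`k`-trees through a new `k`-clique `u`. -/
theorem IsStep.filter_new (h : IsStep k G S v C) {u : Finset V} (hu : u ∈ newCl v C) :
    (Fam k G (insert v S)).filter (u ⊆ ·) =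
      insert u (((Fam k G S).filter (C ⊆ ·)).image fun A : Finset V => insert v A) := by
  have hvu := self_mem_of_mem_newCl hu
  ext A
  simp only [Finset.mem_filter, h.mem_Fam_insert, Finset.mem_insert, Finset.mem_image]
  constructor
  · rintro ⟨hA | hA | ⟨B, hB, hCB, rfl⟩, huA⟩
    · exact absurd ((mem_Fam.1 hA).1 (huA hvu)) h.notMem
    · exact Or.inl (Finset.eq_of_subset_of_card_le huA (by
        rw [(h.isNClique_of_mem_newCl hu).card_eq, (h.isNClique_of_mem_newCl hA).card_eq])).symm
    · exact Or.inr ⟨B, ⟨hB, hCB⟩, rfl⟩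
  · rintro (rfl | ⟨B, ⟨hB, hCB⟩, rfl⟩)
    · exact ⟨Or.inr (Or.inl hu), subset_rfl⟩
    · exact ⟨Or.inr (Or.inr ⟨B, hB, hCB, rfl⟩), (IsStep.subset_insert_of_mem_newCl hu).trans
        (Finset.insert_subset_insert _ hCB)⟩

theorem IsStep.sum_filter_new (h : IsStep k G S v C) {u : Finset V} (hu : u ∈ newCl v C)
    (Φ : Finset V → ℕ) :
    ∑ A ∈ (Fam k G (insert v S)).filter (u ⊆ ·), Φ A =
      Φ u + ∑ A ∈ (Fam k G S).filter (C ⊆ ·), Φ (insert v A) := by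
  have hF : ∀ A ∈ (Fam k G S).filter (C ⊆ ·), v ∉ A := fun A hA hv =>
    h.notMem ((mem_Fam.1 (Finset.mem_filter.1 hA).1).1 hv)
  rw [h.filter_new hu, Finset.sum_insert, Finset.sum_image]
  · intro A hA B hB hAB
    rw [← Finset.erase_insert (hF A hA), ← Finset.erase_insert (hF B hB)]
    exact congrArg (Finset.erase · v) hAB
  · intro hm
    obtain ⟨B, hB, e⟩ := Finset.mem_image.1 hm
    have h1 := (h.isNClique_of_mem_newCl hu).card_eq
    rw [← e, Finset.card_insert_of_notMem (hF B hB)] at h1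
    have := (mem_Fam.1 (Finset.mem_filter.1 hB).1).2.card_le
    omega

variable {d z y r ρ : ℕ}

/-- Every sub-`k`-tree through `C` may independently take `v`, which doubles `z`; the k new cliques
raise only `y`. -/
theorem State.leaf (hs : State k G S C d z y r ρ) (h : IsStep k G S v C) :
    State k G (insert v S) C (d + 1) (2 * z) (y + z + k) (2 * r + z) (ρ + r + z) := by
  have hP : ∀ Φ : Finset V → ℕ, ∑ A ∈ (Fam k G (insert v S)).filter (C ⊆ ·), Φ A =
      ∑ A ∈ (Fam k G S).filter (C ⊆ ·), (Φ A + Φ (insert v A)) := by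
    intro Φ
    rw [Finset.sum_filter, h.sum_Fam_insert, Finset.sum_eq_zero (s := newCl v C)
      fun u hu => if_neg (h.not_subset_new h.subset h.clique.card_eq.ge hu), add_zero,
      Finset.sum_filter]
    refine Finset.sum_congr rfl fun A _ => ?_
    by_cases hCA : C ⊆ A
    · simp [hCA, hCA.trans (Finset.subset_insert v A)]
    · simp [hCA]
  refine ⟨KT.step _ _ _ hs.kt h, ?_, ?_, ?_, ?_, ?_, ?_, ?_⟩
  · rw [h.Cl_insert]; exact Finset.mem_union_left _ hs.mem
  · intro q hq hqC
    rw [h.Cl_insert] at hq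
    rcases Finset.mem_union.1 hq with hq | hq
    · rw [h.deg_insert_of_ne hq hqC]
      exact hs.deg_ne q hq hqC
    · rw [h.deg_insert_new hq]; omega
  · rw [h.deg_insert_self, hs.deg_eq]
  · have := hP (fun _ => 1)
    simp only [Finset.sum_const, smul_eq_mul, mul_one, hs.card_through] at this
    omega
  · rw [h.card_Fam_insert, hs.card_all, hs.card_through]
  · rw [hP, Finset.sum_congr rfl fun A hA => by
      rw [h.card_insert_sub (Finset.mem_filter.1 hA).1], Finset.sum_add_distrib,
      Finset.sum_add_distrib, hs.sum_through]
    simp only [Finset.sum_const, smul_eq_mul, mul_one, hs.card_through]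
    omega
  · rw [h.sum_card_Fam_insert, hs.sum_all, hs.sum_through, hs.card_through]

/-- The sub-`k`-trees through the new current clique are that clique itself and `insert v A` for `A`
through `C`. The old `C` is now final, so its degree `d + 1` must not be 2. -/
theorem State.extend (hs : State k G S C d z y r ρ) (h : IsStep k G S v C) (hd : d + 1 ≠ 2)
    {x : V} (hx : x ∈ C) :
    State k G (insert v S) (insert v (C.erase x)) 1 (z + 1) (y + z + k) (r + z) (ρ + r + z) := by
  have hu : insert v (C.erase x) ∈ newCl v C := mem_newCl.2 ⟨x, hx, rfl⟩
  refine ⟨KT.step _ _ _ hs.kt h, ?_, ?_, h.deg_insert_new hu, ?_, ?_, ?_, ?_⟩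
  · rw [h.Cl_insert]; exact Finset.mem_union_right _ hu
  · intro q hq _
    rw [h.Cl_insert] at hq
    rcases Finset.mem_union.1 hq with hq | hq
    · by_cases hqC : q = C
      · rw [hqC, h.deg_insert_self, hs.deg_eq]; exact hd
      · rw [h.deg_insert_of_ne hq hqC]
        exact hs.deg_ne q hq hqC
    · rw [h.deg_insert_new hq]; omega
  · have := h.sum_filter_new hu (fun _ => 1)
    simp only [Finset.sum_const, smul_eq_mul, mul_one, hs.card_through] at this
    omega
  · rw [h.card_Fam_insert, hs.card_all, hs.card_through]
  · rw [h.sum_filter_new hu, (h.isNClique_of_mem_newCl hu).card_eq, Finset.sum_congr rfl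
      fun A hA => h.card_insert_sub (Finset.mem_filter.1 hA).1, Finset.sum_add_distrib,
      hs.sum_through]
    simp only [Finset.sum_const, smul_eq_mul, mul_one, hs.card_through]
    omega
  · rw [h.sum_card_Fam_insert, hs.sum_all, hs.sum_through, hs.card_through]

/-- A `k`-star. -/
theorem State.star {c : Finset V} (hc : G.IsNClique k c) (X : Finset V) :
    Disjoint c X → (∀ x ∈ X, ∀ w ∈ c ∪ X, G.Adj x w ↔ w ∈ c) →
      ∃ r, 2 * r = X.card * 2 ^ X.card ∧
        State k G (c ∪ X) c X.card (2 ^ X.card) (2 ^ X.card + k * X.card) r r := by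
  induction X using Finset.induction_on with
  | empty =>
    intro _ _
    exact ⟨0, by simp, by simpa using State.base hc⟩
  | insert x X hx ih =>
    intro hd hadj
    rw [Finset.disjoint_insert_right] at hd
    obtain ⟨r, hr, hs⟩ := ih hd.2 fun y hy w hw => hadj y (Finset.mem_insert_of_mem hy) w
      (Finset.union_subset_union_right (Finset.subset_insert _ _) hw)
    have hst : IsStep k G (c ∪ X) x c :=
      ⟨by simp [hd.1, hx], Finset.subset_union_left, hc, fun w hw => hadj x
        (Finset.mem_insert_self _ _) w
        (Finset.union_subset_union_right (Finset.subset_insert _ _) hw)⟩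
    refine ⟨2 * r + 2 ^ X.card, ?_, ?_⟩
    · rw [Finset.card_insert_of_notMem hx, pow_succ]
      linarith
    · have := hs.leaf hst
      rw [Finset.union_insert, Finset.card_insert_of_notMem hx, pow_succ, mul_comm (2 ^ X.card)]
      convert this using 1 <;> ring

end State

section Univ

variable {V : Type u} [Fintype V] [DecidableEq V] {k : ℕ} {G : SimpleGraph V}

theorem sum_card_Fam {S : Finset V} :
    ∑ A ∈ Fam k G S, (A.card : ℝ) =
      ((∑ A ∈ Fam k G S, (A.card - k) : ℕ) : ℝ) + k * (Fam k G S).card := by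
  rw [Nat.cast_sum, mul_comm, ← nsmul_eq_mul, ← Finset.sum_const, ← Finset.sum_add_distrib]
  refine Finset.sum_congr rfl fun A hA => ?_
  rw [Nat.cast_sub (mem_Fam.1 hA).2.card_le]
  ring

theorem KT.card_Fam_pos {S : Finset V} (h : KT k G S) : 0 < (Fam k G S).card :=
  Finset.card_pos.2 ⟨S, mem_Fam.2 ⟨subset_rfl, h⟩⟩

theorem globalMean_eq_add (hG : KT k G Finset.univ) :
    globalMean k G = k + ((∑ A ∈ Fam k G Finset.univ, (A.card - k) : ℕ) : ℝ) /
      (Fam k G Finset.univ).card := by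
  have : ((Fam k G Finset.univ).card : ℝ) ≠ 0 := by exact_mod_cast hG.card_Fam_pos.ne'
  rw [globalMean_eq hG, sum_card_Fam]
  field_simp
  ring

theorem State.globalMean {C : Finset V} {d z y r ρ : ℕ}
    (hs : State k G Finset.univ C d z y r ρ) : globalMean k G = k + (ρ : ℝ) / y := by
  rw [globalMean_eq_add hs.kt, hs.sum_all, hs.card_all]

theorem State.noCliqueOfDegreeTwo {C : Finset V} {d z y r ρ : ℕ}
    (hs : State k G Finset.univ C d z y r ρ) (hd : d ≠ 2) : NoCliqueOfDegreeTwo k G := by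
  rw [noCliqueOfDegreeTwo_iff]
  intro q hq
  by_cases hqC : q = C
  · rw [hqC, hs.deg_eq]; exact hd
  · exact hs.deg_ne q hq hqC

/-- The mean of a `k`-star with `m` vertices outside the central `k`-clique. -/
theorem globalMean_star {c : Finset V} (hc : G.IsNClique k c)
    (hadj : ∀ x, x ∉ c → ∀ w, G.Adj x w ↔ w ∈ c) :
    ∃ r, State k G Finset.univ c (Fintype.card V - k) (2 ^ (Fintype.card V - k))
        (2 ^ (Fintype.card V - k) + k * (Fintype.card V - k)) r r ∧
      globalMean k G = k + ((Fintype.card V - k : ℕ) : ℝ) / 2 * 2 ^ (Fintype.card V - k) /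
        (2 ^ (Fintype.card V - k) + k * (Fintype.card V - k : ℕ)) := by
  obtain ⟨r, hr, hs⟩ := State.star hc cᶜ disjoint_compl_right
    fun x hx w _ => hadj x (Finset.mem_compl.1 hx) w
  rw [Finset.union_compl, Finset.card_compl, hc.card_eq] at *
  refine ⟨r, hs, ?_⟩
  rw [hs.globalMean]
  have : (r : ℝ) = ((Fintype.card V - k : ℕ) : ℝ) / 2 * 2 ^ (Fintype.card V - k) := by
    have : ((2 * r : ℕ) : ℝ) = ((Fintype.card V - k) * 2 ^ (Fintype.card V - k) : ℕ) := by
      exact_mod_cast hr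
    push_cast at this
    linarith
  rw [this]
  push_cast
  rfl

/-! ### The lower bound -/

/-- Growing from `c`, each step creates the `(k+1)`-clique `insert v C`; if this contains `c`, then
`C = c`. -/
theorem KT.star_of_forall {c S : Finset V} (hS : KT k G S) (hc : G.IsNClique k c)
    (hcS : c ⊆ S) : (∀ e ∈ Cl (k + 1) G S, c ⊆ e) →
      ∀ x ∈ S, x ∉ c → ∀ w ∈ S, G.Adj x w ↔ w ∈ c := by
  refine (KT.base c hc).grow_induction (motive := fun S => (∀ e ∈ Cl (k + 1) G S, c ⊆ e) →
      ∀ x ∈ S, x ∉ c → ∀ w ∈ S, G.Adj x w ↔ w ∈ c) ?_ ?_ hS hcS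
  · exact fun _ x hx hxc => absurd hx hxc
  · intro S v C _ hcS hst ih hall
    rw [hst.Cl_succ_insert] at hall
    have hcC : c = C := Finset.eq_of_subset_of_card_le
      ((subset_insert_iff_of_subset hst.notMem hcS).1 (hall _ (Finset.mem_insert_self _ _)))
      (by rw [hc.card_eq, hst.clique.card_eq])
    subst hcC
    have ih := ih fun e he => hall e (Finset.mem_insert_of_mem he)
    intro x hx hxc w hw
    rcases Finset.mem_insert.1 hx with rfl | hx'
    · rcases Finset.mem_insert.1 hw with rfl | hw'
      · simp [hxc]
      · exact hst.adj w hw'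
    · rcases Finset.mem_insert.1 hw with rfl | hw'
      · rw [SimpleGraph.adj_comm, hst.adj x hx']
        simp [hxc, hst.notMem_clique]
      · exact ih x hx' hxc w hw'

theorem KT.Cl_nonempty {S : Finset V} (hS : KT k G S) : (Cl k G S).Nonempty := by
  cases hS with
  | base _ h => exact ⟨S, mem_Cl.2 ⟨subset_rfl, h⟩⟩
  | step S v C hS hst =>
    exact ⟨C, mem_Cl.2 ⟨hst.subset.trans (Finset.subset_insert _ _), hst.clique⟩⟩

/-- Outside the star case the sum is at least x(m/2 + 1/10), with x the number of sub-`k`-trees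
through `c`. The at most k·m·√x others can cost m/2 each, which is less than x/10 in total once
5k·m² < √x. -/
theorem star_or_half_lt {S : Finset V} (hS : KT k G S)
    (hd : ∀ q ∈ Cl k G S, deg k G S q ≠ 2)
    (hm : (5 * (k : ℝ) * (S.card - k : ℕ) ^ 2) ^ 4 < 2 ^ (S.card - k)) :
    (∃ c ∈ Cl k G S, ∀ x ∈ S, x ∉ c → ∀ w ∈ S, G.Adj x w ↔ w ∈ c) ∨
      ((S.card - k : ℕ) : ℝ) / 2 * (Fam k G S).card <
        ((∑ A ∈ Fam k G S, (A.card - k) : ℕ) : ℝ) := by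
  obtain ⟨c, hc, hmax⟩ := Finset.exists_max_image (Cl k G S)
    (fun c => ((Fam k G S).filter (c ⊆ ·)).card) hS.Cl_nonempty
  obtain ⟨hcS, hcl⟩ := mem_Cl.1 hc
  by_cases hstar : ∀ e ∈ Cl (k + 1) G S, c ⊆ e
  · exact Or.inl ⟨c, hc, hS.star_of_forall hcl hcS hstar⟩
  right
  set m := S.card - k with hmdef
  have hcard := hS.card_Cl_succ
  have hne : m ≠ deg k G S c := by
    intro h
    have : (Cl (k + 1) G S).filter (c ⊆ ·) = Cl (k + 1) G S :=
      Finset.eq_of_subset_of_card_le (Finset.filter_subset _ _) (by rw [deg] at h; omega)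
    exact hstar (Finset.filter_eq_self.1 this)
  obtain ⟨x, y, hx, hxy, hinv⟩ := exists_inv hS hc (fun _ => 1) (fun _ => 0) (fun _ => 0)
    (fun _ => 0) (fun q _ => ⟨le_rfl, by norm_num, by norm_num, le_rfl, fun _ => rfl⟩)
    (by simpa using fun q hq _ => hd q hq)
  rw [sum_wt_one] at hx
  simp only [Finset.sum_const_zero, zero_add] at hinv
  have hxsum : ((∑ A ∈ (Fam k G S).filter (c ⊆ ·), (A.card - k) : ℕ) : ℝ) = x * y := by
    rw [← hxy, Nat.cast_sum]
    refine Finset.sum_congr rfl fun A hA => ?_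
    rw [Nat.cast_sub (mem_Fam.1 (Finset.mem_filter.1 hA).1).2.card_le]
    simp [wt, size]
  have hy : (m : ℝ) / 2 + 1 / 10 ≤ y := by
    have := hinv.mean
    rwa [if_neg hne] at this
  have hx1 := hinv.one_le
  have hx2 : (2 : ℝ) ^ m ≤ x ^ 2 :=
    (pow_le_pow_right₀ (by norm_num) (Nat.le_add_right _ _)).trans hinv.pow_le
  -- By maximality of `c`, at most as many sub-`k`-trees contain `u` without `c` as `c` without `u`.
  -- So the square of the former number is at most the product in `card_mul_card_le`, hence at most
  -- x.
  have hB : ∀ u ∈ Cl k G S, u ≠ c → (∃ e ∈ Cl (k + 1) G S, c ⊆ e ∧ u ⊆ e) →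
      (((Fam k G S).filter fun A => u ⊆ A ∧ ¬ c ⊆ A).card : ℝ) ≤ √x := by
    intro u hu huc ⟨e, he, hce, hue⟩
    have h1 := card_mul_card_le hS hcl (mem_Cl.1 hu).2 (mem_Cl.1 he).2 (mem_Cl.1 he).1 hce hue
      huc.symm
    have h2 := hmax u hu
    have h3 : ∀ a b : Finset V, ((Fam k G S).filter (a ⊆ ·)).card =
        ((Fam k G S).filter fun A => a ⊆ A ∧ b ⊆ A).card +
          ((Fam k G S).filter fun A => a ⊆ A ∧ ¬ b ⊆ A).card := by
      intro a b
      rw [← Finset.card_filter_add_card_filter_not (s := (Fam k G S).filter (a ⊆ ·)) (b ⊆ ·),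
        Finset.filter_filter, Finset.filter_filter]
    have h4 := h3 c u
    have h5 := h3 u c
    have h6 : ((Fam k G S).filter fun A => u ⊆ A ∧ c ⊆ A) =
        (Fam k G S).filter fun A => c ⊆ A ∧ u ⊆ A :=
      Finset.filter_congr fun A _ => and_comm
    rw [h6] at h5
    refine Real.le_sqrt_of_sq_le ?_
    rw [← hx]
    have h7 : ((Fam k G S).filter fun A => u ⊆ A ∧ ¬ c ⊆ A).card ^ 2 ≤
        ((Fam k G S).filter (c ⊆ ·)).card := by
      rw [sq]
      refine (Nat.mul_le_mul_left _ ?_).trans (h1.trans ?_) <;> omega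
    exact_mod_cast h7
  have hG := card_avoid_le hS hcl hcS hB
  have htot : ((Fam k G S).card : ℝ) =
      x + ((Fam k G S).filter fun A => ¬ c ⊆ A).card := by
    rw [← hx, ← Finset.card_filter_add_card_filter_not (c ⊆ ·)]
    push_cast
    rfl
  have hsum : x * y ≤ ((∑ A ∈ Fam k G S, (A.card - k) : ℕ) : ℝ) := by
    rw [← hxsum]
    exact_mod_cast Finset.sum_le_sum_of_subset (Finset.filter_subset _ _)
  set X := √x with hX
  have hX0 : 0 ≤ X := Real.sqrt_nonneg x
  have hXx : X ^ 2 = x := Real.sq_sqrt (by linarith)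
  -- Fourth powers appear because X⁴ = x² is the quantity bounded below by 2^m.
  have hXm : 5 * (k : ℝ) * m ^ 2 < X := by
    refine lt_of_pow_lt_pow_left₀ 4 hX0 (hm.trans_le (hx2.trans ?_))
    rw [← hXx]
    exact le_of_eq (by ring)
  have hXpos : 0 < X := lt_of_le_of_lt (by positivity) hXm
  rw [htot]
  refine lt_of_lt_of_le ?_ hsum
  have h8 : (m : ℝ) / 2 * ((Fam k G S).filter fun A => ¬ c ⊆ A).card ≤
      (m : ℝ) / 2 * (k * m * X) := mul_le_mul_of_nonneg_left hG (by positivity)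
  have h9 : (m : ℝ) / 2 * (k * m * X) < x / 10 := by
    rw [← hXx]
    nlinarith
  nlinarith

end Univ

end SubKTree

namespace SubKTree

/-! ### Isomorphisms -/

section Iso

variable {V : Type u} [Fintype V] [DecidableEq V] {W : Type v} [Fintype W] [DecidableEq W] {k : ℕ}
  {G : SimpleGraph V} {H : SimpleGraph W}

theorem map_symm_map (e : G ≃g H) (B : Finset W) :
    (B.map e.symm.toEmbedding.toEmbedding).map e.toEmbedding.toEmbedding = B := by
  rw [Finset.map_map]
  convert Finset.map_refl
  ext x
  exact e.apply_symm_apply x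

theorem map_map_symm (e : G ≃g H) (A : Finset V) :
    (A.map e.toEmbedding.toEmbedding).map e.symm.toEmbedding.toEmbedding = A := by
  rw [Finset.map_map]
  convert Finset.map_refl
  ext x
  exact e.symm_apply_apply x

theorem globalMean_iso (e : G ≃g H) (hG : KT k G Finset.univ) (hH : KT k H Finset.univ) :
    globalMean k G = globalMean k H := by
  have key : ∀ f : ℕ → ℝ, ∑ A ∈ Fam k G Finset.univ, f A.card =
      ∑ A ∈ Fam k H Finset.univ, f A.card := by
    intro f
    refine Finset.sum_nbij' (fun A => A.map e.toEmbedding.toEmbedding)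
      (fun A => A.map e.symm.toEmbedding.toEmbedding) ?_ ?_ ?_ ?_ ?_
    · exact fun A hA => mem_Fam.2 ⟨Finset.subset_univ _, (mem_Fam.1 hA).2.map e.toEmbedding⟩
    · exact fun A hA => mem_Fam.2 ⟨Finset.subset_univ _, (mem_Fam.1 hA).2.map e.symm.toEmbedding⟩
    · exact fun A _ => map_map_symm e A
    · exact fun A _ => map_symm_map e A
    · exact fun A _ => by rw [Finset.card_map]
  have h1 := key (fun n => (n : ℝ))
  have h2 := key (fun _ => 1)
  simp only [Finset.sum_const, nsmul_eq_mul, mul_one] at h2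
  rw [globalMean_eq hG, globalMean_eq hH, h1, h2]

theorem deg_map (e : G ≃g H) (q : Finset V) :
    deg k H Finset.univ (q.map e.toEmbedding.toEmbedding) = deg k G Finset.univ q := by
  symm
  refine Finset.card_bij (fun A _ => A.map e.toEmbedding.toEmbedding) ?_ ?_ ?_
  · intro A hA
    obtain ⟨h1, h2⟩ := Finset.mem_filter.1 hA
    exact Finset.mem_filter.2 ⟨mem_Cl.2 ⟨Finset.subset_univ _,
      isNClique_map_embedding e.toEmbedding (mem_Cl.1 h1).2⟩, Finset.map_subset_map.2 h2⟩
  · exact fun A _ B _ h => Finset.map_injective _ h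
  · intro B hB
    obtain ⟨h1, h2⟩ := Finset.mem_filter.1 hB
    have hB' := map_symm_map e B
    refine ⟨B.map e.symm.toEmbedding.toEmbedding, Finset.mem_filter.2 ⟨mem_Cl.2
      ⟨Finset.subset_univ _, isNClique_map_embedding e.symm.toEmbedding (mem_Cl.1 h1).2⟩, ?_⟩, hB'⟩
    rw [← hB'] at h2
    exact Finset.map_subset_map.1 h2

theorem noCliqueOfDegreeTwo_iso (e : G ≃g H) (hG : NoCliqueOfDegreeTwo k G) :
    NoCliqueOfDegreeTwo k H := by
  rw [noCliqueOfDegreeTwo_iff] at *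
  intro C hC
  rw [← map_symm_map e C, deg_map]
  exact hG _ (mem_Cl.2 ⟨Finset.subset_univ _,
    isNClique_map_embedding e.symm.toEmbedding (mem_Cl.1 hC).2⟩)

end Iso

/-! ### The `k`-star -/

section Star

variable {k n : ℕ}

theorem kStar_adj {i j : Fin n} : (kStar k n).Adj i j ↔ i ≠ j ∧ (i.val < k ∨ j.val < k) := by
  simp [kStar, SimpleGraph.fromRel_adj]

theorem card_filter_lt (h : k ≤ n) : (Finset.univ.filter fun i : Fin n => i.val < k).card = k := by
  rw [Fin.card_filter_val_lt]
  omega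

theorem kStar_isNClique (h : k ≤ n) :
    (kStar k n).IsNClique k (Finset.univ.filter fun i : Fin n => i.val < k) := by
  refine ⟨fun i hi j _ hne => kStar_adj.2 ⟨hne, Or.inl ?_⟩, card_filter_lt h⟩
  simpa using hi

theorem kStar_adj_iff (x : Fin n) (hx : x ∉ Finset.univ.filter fun i : Fin n => i.val < k)
    (w : Fin n) : (kStar k n).Adj x w ↔ w ∈ Finset.univ.filter fun i : Fin n => i.val < k := by
  simp only [Finset.mem_filter, Finset.mem_univ, true_and] at hx
  simp only [kStar_adj, Finset.mem_filter, Finset.mem_univ, true_and]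
  constructor
  · rintro ⟨_, h | h⟩
    · exact absurd h hx
    · exact h
  · exact fun h => ⟨fun e => hx (e ▸ h), Or.inr h⟩

theorem isKTree_kStar (h : k ≤ n) : IsKTree k (kStar k n) := by
  obtain ⟨r, hs, -⟩ := globalMean_star (kStar_isNClique h) kStar_adj_iff
  exact isKTree_iff_KT_univ.2 hs.kt

theorem noCliqueOfDegreeTwo_kStar (h : k + 3 ≤ n) : NoCliqueOfDegreeTwo k (kStar k n) := by
  obtain ⟨r, hs, -⟩ := globalMean_star (kStar_isNClique (by omega : k ≤ n)) kStar_adj_iff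
  refine hs.noCliqueOfDegreeTwo ?_
  rw [Fintype.card_fin]
  omega

theorem globalMean_kStar (h : k ≤ n) :
    globalMean k (kStar k n) = k + ((n - k : ℕ) : ℝ) / 2 * 2 ^ (n - k) /
      (2 ^ (n - k) + k * (n - k : ℕ)) := by
  obtain ⟨r, -, h⟩ := globalMean_star (kStar_isNClique h) kStar_adj_iff
  rw [h, Fintype.card_fin]

theorem globalMean_kStar_le (h : k ≤ n) :
    globalMean k (kStar k n) ≤ k + ((n - k : ℕ) : ℝ) / 2 := by
  rw [globalMean_kStar h]
  refine add_le_add le_rfl ?_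
  rw [div_le_iff₀ (by positivity)]
  gcongr
  have : (0 : ℝ) ≤ k * (n - k : ℕ) := by positivity
  linarith

theorem tendsto_natPow_div_two_pow (j : ℕ) :
    Tendsto (fun m : ℕ => (m : ℝ) ^ j / 2 ^ m) atTop (𝓝 0) :=
  tendsto_pow_const_div_const_pow_of_one_lt j (by norm_num)

theorem tendsto_kStar (k : ℕ) :
    Tendsto (fun n : ℕ => ((n : ℝ) + k) / 2 - globalMean k (kStar k n)) atTop (𝓝 0) := by
  rw [← tendsto_add_atTop_iff_nat k]
  have h1 : Tendsto (fun m : ℕ => (k : ℝ) / 2 * ((m : ℝ) ^ 2 / 2 ^ m)) atTop (𝓝 0) := by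
    simpa using (tendsto_natPow_div_two_pow 2).const_mul ((k : ℝ) / 2)
  have hEq : ∀ m : ℕ, (((m + k : ℕ) : ℝ) + k) / 2 - globalMean k (kStar k (m + k)) =
      (k : ℝ) / 2 * m ^ 2 / (2 ^ m + k * m) := by
    intro m
    rw [globalMean_kStar (Nat.le_add_left _ _), Nat.add_sub_cancel]
    have : (2 : ℝ) ^ m + k * m ≠ 0 := by positivity
    push_cast
    field_simp
    ring
  refine squeeze_zero (fun m => ?_) (fun m => ?_) h1
  · rw [hEq]; positivity
  · rw [hEq, mul_div_assoc]
    gcongr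
    have : (0 : ℝ) ≤ k * m := by positivity
    linarith

theorem nonempty_iso_kStar {V : Type u} [Fintype V] [DecidableEq V] {T : SimpleGraph V}
    (hn : Fintype.card V = n) {c : Finset V} (hc : T.IsNClique k c)
    (hadj : ∀ x, x ∉ c → ∀ w, T.Adj x w ↔ w ∈ c) : Nonempty (T ≃g kStar k n) := by
  have hkn : k ≤ n := by
    rw [← hn, ← hc.card_eq]; exact Finset.card_le_univ c
  have h1 : Fintype.card {x // x ∈ c} = Fintype.card {i : Fin n // i.val < k} := by
    rw [Fintype.card_coe, hc.card_eq, Fintype.card_subtype, card_filter_lt hkn]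
  have h2 : Fintype.card {x // ¬ x ∈ c} = Fintype.card {i : Fin n // ¬ i.val < k} := by
    rw [Fintype.card_subtype_compl, Fintype.card_subtype_compl, h1, hn, Fintype.card_fin]
  let e : V ≃ Fin n := (Equiv.sumCompl (· ∈ c)).symm.trans
    ((Equiv.sumCongr (Fintype.equivOfCardEq h1) (Fintype.equivOfCardEq h2)).trans
      (Equiv.sumCompl fun i : Fin n => i.val < k))
  have he : ∀ x, (e x).val < k ↔ x ∈ c := by
    intro x
    by_cases hx : x ∈ c
    · simp only [hx, iff_true, e, Equiv.trans_apply]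
      rw [Equiv.sumCompl_symm_apply_of_pos (p := (· ∈ c)) hx]
      exact ((Fintype.equivOfCardEq h1) ⟨x, hx⟩).2
    · simp only [hx, iff_false, e, Equiv.trans_apply]
      rw [Equiv.sumCompl_symm_apply_of_neg (p := (· ∈ c)) hx]
      exact ((Fintype.equivOfCardEq h2) ⟨x, hx⟩).2
  refine ⟨⟨e, fun {a b} => ?_⟩⟩
  rw [kStar_adj, he, he]
  constructor
  · rintro ⟨hne, h⟩
    have hab : a ≠ b := fun h => hne (by rw [h])
    by_cases ha : a ∈ c
    · by_cases hb : b ∈ c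
      · exact hc.isClique ha hb hab
      · exact ((hadj b hb a).2 ha).symm
    · exact (hadj a ha b).2 (h.resolve_left ha)
  · intro h
    refine ⟨fun h' => h.ne (e.injective h'), ?_⟩
    by_cases ha : a ∈ c
    · exact Or.inl ha
    · exact Or.inr ((hadj a ha b).1 h)

end Star

/-! ### Extremality of the star and the two bounds -/

theorem eventually_pow_lt (k : ℕ) :
    ∃ N, ∀ n, N ≤ n → (5 * (k : ℝ) * (n - k : ℕ) ^ 2) ^ 4 < 2 ^ (n - k) := by
  have h1 : Tendsto (fun m : ℕ => (5 * (k : ℝ)) ^ 4 * ((m : ℝ) ^ 8 / 2 ^ m)) atTop (𝓝 0) := by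
    simpa using (tendsto_natPow_div_two_pow 8).const_mul ((5 * (k : ℝ)) ^ 4)
  obtain ⟨M, hM⟩ := eventually_atTop.1 (h1.eventually_lt_const zero_lt_one)
  refine ⟨M + k, fun n hn => ?_⟩
  have := hM (n - k) (by omega)
  rw [← mul_div_assoc, div_lt_one (by positivity)] at this
  calc (5 * (k : ℝ) * (n - k : ℕ) ^ 2) ^ 4 = (5 * (k : ℝ)) ^ 4 * ((n - k : ℕ) : ℝ) ^ 8 := by ring
    _ < _ := this

theorem extremal_kStar (k : ℕ) : ∃ n₀ : ℕ, k + 3 ≤ n₀ ∧ ∀ n : ℕ, n₀ ≤ n →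
    ∀ (V : Type u) [Fintype V] (T : SimpleGraph V),
      Fintype.card V = n → IsKTree k T → NoCliqueOfDegreeTwo k T →
      globalMean k (kStar k n) ≤ globalMean k T ∧
      (globalMean k T = globalMean k (kStar k n) ↔ Nonempty (T ≃g kStar k n)) := by
  classical
  obtain ⟨N, hN⟩ := eventually_pow_lt k
  refine ⟨max N (k + 3), le_max_right _ _, fun n hn V _ T hV hT hd => ?_⟩
  have hkn : k ≤ n := by have := le_max_right N (k + 3); omega
  have hK := isKTree_iff_KT_univ.1 hT
  have hS := isKTree_iff_KT_univ.1 (isKTree_kStar hkn)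
  rw [noCliqueOfDegreeTwo_iff] at hd
  have hiso : Nonempty (T ≃g kStar k n) → globalMean k T = globalMean k (kStar k n) :=
    fun ⟨e⟩ => globalMean_iso e hK hS
  rcases star_or_half_lt hK hd (by
    rw [Finset.card_univ, hV]; exact hN n (le_trans (le_max_left _ _) hn)) with
    ⟨c, hc, hadj⟩ | hlt
  · have hI := nonempty_iso_kStar hV (mem_Cl.1 hc).2
      fun x hx w => hadj x (Finset.mem_univ _) hx w (Finset.mem_univ _)
    exact ⟨(hiso hI).ge, fun _ => hI, hiso⟩
  · have hpos : (0 : ℝ) < (Fam k T Finset.univ).card := by exact_mod_cast hK.card_Fam_pos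
    have h1 : globalMean k (kStar k n) < globalMean k T := by
      refine (globalMean_kStar_le hkn).trans_lt ?_
      rw [globalMean_eq_add hK]
      rw [Finset.card_univ, hV] at hlt
      refine add_lt_add_of_le_of_lt le_rfl ?_
      rwa [lt_div_iff₀ hpos]
    exact ⟨h1.le, fun h => absurd h h1.ne', hiso⟩

theorem lower_bound (k : ℕ) : ∃ ε : ℕ → ℝ, Tendsto ε atTop (𝓝 0) ∧
    ∀ (V : Type u) [Fintype V] (T : SimpleGraph V),
      IsKTree k T → NoCliqueOfDegreeTwo k T →
      ((Fintype.card V : ℝ) + k) / 2 - ε (Fintype.card V) < globalMean k T := by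
  obtain ⟨N, -, hN⟩ := extremal_kStar.{u} k
  -- For large n the term 1/(n + 1) makes the comparison with the star strict; for small n the value
  -- makes the lower bound negative, hence trivial.
  refine ⟨fun n => if N ≤ n then ((n : ℝ) + k) / 2 - globalMean k (kStar k n) + 1 / ((n : ℝ) + 1)
    else ((n : ℝ) + k) / 2 + 1, ?_, ?_⟩
  · have h := (tendsto_kStar k).add (tendsto_one_div_add_atTop_nhds_zero_nat (𝕜 := ℝ))
    rw [add_zero] at h
    refine h.congr' ?_
    filter_upwards [eventually_ge_atTop N] with n hn
    rw [if_pos hn]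
  · intro V _ T hT hd
    dsimp only
    split_ifs with hn
    · have h1 := (hN _ hn V T rfl hT hd).1
      have h2 : (0 : ℝ) < 1 / ((Fintype.card V : ℝ) + 1) := by positivity
      linarith
    · have : 0 ≤ globalMean k T := by unfold globalMean; positivity
      linarith

theorem upper_bound {k : ℕ} (hk : 1 ≤ k) {V : Type u} [Fintype V] {T : SimpleGraph V}
    (hT : IsKTree k T) (hd : NoCliqueOfDegreeTwo k T) (hn : k + 2 ≤ Fintype.card V) :
    globalMean k T < (3 * (Fintype.card V : ℝ) + k - 3) / 4 := by
  classical
  have hK := isKTree_iff_KT_univ.1 hT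
  rw [globalMean_eq hK, div_lt_iff₀ (by exact_mod_cast hK.card_Fam_pos)]
  exact sum_card_lt hk hK hn (noCliqueOfDegreeTwo_iff.1 hd)

end SubKTree

namespace SubKTree

/-! ### The `k`-caterpillar -/

section Caterpillar

variable {k t : ℕ}

theorem kCaterpillar_adj_inl_inl {i j : Fin (k + t)} :
    (kCaterpillar k t).Adj (.inl i) (.inl j) ↔
      i.val ≠ j.val ∧ i.val ≤ j.val + k ∧ j.val ≤ i.val + k := by
  simp only [kCaterpillar, SimpleGraph.fromRel_adj, kCaterpillarRel, ne_eq, Sum.inl.injEq,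
    Fin.ext_iff]
  omega

theorem kCaterpillar_adj_inr_inl {a : Fin (t + 1)} {i : Fin (k + t)} :
    (kCaterpillar k t).Adj (.inr (.inl a)) (.inl i) ↔ a.val ≤ i.val ∧ i.val < a.val + k := by
  simp [kCaterpillar, SimpleGraph.fromRel_adj, kCaterpillarRel]

theorem kCaterpillar_adj_inr_false {i : Fin (k + t)} :
    (kCaterpillar k t).Adj (.inr (.inr false)) (.inl i) ↔ i.val < k := by
  simp [kCaterpillar, SimpleGraph.fromRel_adj, kCaterpillarRel]

theorem kCaterpillar_adj_inr_true {i : Fin (k + t)} :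
    (kCaterpillar k t).Adj (.inr (.inr true)) (.inl i) ↔ t ≤ i.val := by
  simp [kCaterpillar, SimpleGraph.fromRel_adj, kCaterpillarRel]

theorem kCaterpillar_not_adj_inr_inr {x y : Fin (t + 1) ⊕ Bool} :
    ¬ (kCaterpillar k t).Adj (.inr x) (.inr y) := by
  rcases x with x | (_ | _) <;> rcases y with y | (_ | _) <;>
    simp [kCaterpillar, SimpleGraph.fromRel_adj, kCaterpillarRel]

theorem kCaterpillar_not_adj_inl_inr_inl {a : Fin (t + 1)} {i : Fin (k + t)}
    (h : a.val + k ≤ i.val) : ¬ (kCaterpillar k t).Adj (.inl i) (.inr (.inl a)) := by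
  rw [SimpleGraph.adj_comm, kCaterpillar_adj_inr_inl]
  omega

theorem kCaterpillar_not_adj_inl_inr_false {i : Fin (k + t)} (h : k ≤ i.val) :
    ¬ (kCaterpillar k t).Adj (.inl i) (.inr (.inr false)) := by
  rw [SimpleGraph.adj_comm, kCaterpillar_adj_inr_false]
  omega

/-- Membership in the `j`-th set of `k` consecutive stem vertices. -/
def InWindow (k t j : ℕ) : Fin (k + t) ⊕ (Fin (t + 1) ⊕ Bool) → Prop
  | .inl i => j ≤ i.val ∧ i.val < j + k
  | .inr _ => False

/-- Membership in the part of the caterpillar up to the `j`-th window and its `k`-leaf. -/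
def InPart (k t j : ℕ) : Fin (k + t) ⊕ (Fin (t + 1) ⊕ Bool) → Prop
  | .inl i => i.val < k + j
  | .inr (.inl a) => a.val ≤ j
  | .inr (.inr b) => b = false

open Classical in
noncomputable def window (k t j : ℕ) : Finset (Fin (k + t) ⊕ (Fin (t + 1) ⊕ Bool)) :=
  Finset.univ.filter (InWindow k t j)

open Classical in
noncomputable def part (k t j : ℕ) : Finset (Fin (k + t) ⊕ (Fin (t + 1) ⊕ Bool)) :=
  Finset.univ.filter (InPart k t j)

theorem mem_window {j : ℕ} {x} : x ∈ window k t j ↔ InWindow k t j x := by simp [window]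

theorem mem_part {j : ℕ} {x} : x ∈ part k t j ↔ InPart k t j x := by simp [part]

theorem isNClique_window_zero : (kCaterpillar k t).IsNClique k (window k t 0) := by
  constructor
  · rintro (i | i) hi (j | j) hj hne <;>
      simp only [Finset.mem_coe, mem_window, InWindow] at hi hj
    rw [kCaterpillar_adj_inl_inl]
    have : i.val ≠ j.val := fun h => hne (by rw [Fin.ext h])
    omega
  · have : window k t 0 = Finset.univ.map
        ⟨fun i : Fin k => Sum.inl (Fin.castAdd t i), fun i j h => by simpa using h⟩ := by
      ext (i | i)
      · simp only [mem_window, InWindow, Finset.mem_map, Finset.mem_univ, true_and]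
        constructor
        · exact fun h => ⟨⟨i.val, by omega⟩, congrArg Sum.inl (Fin.ext rfl)⟩
        · rintro ⟨a, h⟩
          obtain rfl : Fin.castAdd t a = i := Sum.inl.inj h
          have := a.2
          rw [Fin.val_castAdd]
          omega
      · simp [mem_window, InWindow]
    rw [this, Finset.card_map, Finset.card_univ, Fintype.card_fin]

theorem state_part_zero :
    State k (kCaterpillar k t) (part k t 0) (window k t 0) 2 4 (2 * k + 4) 4 4 := by
  have h0 : State k (kCaterpillar k t) _ _ 0 1 1 0 0 := State.base isNClique_window_zero
  have h1 := h0.leaf (v := .inr (.inr false)) ⟨by simp [mem_window, InWindow], subset_rfl,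
    isNClique_window_zero, by
      rintro (i | i) hi
      · rw [kCaterpillar_adj_inr_false, mem_window, InWindow]
        omega
      · exact absurd hi (by simp [mem_window, InWindow])⟩
  have h2 := h1.leaf (v := .inr (.inl 0)) ⟨by simp [mem_window, InWindow],
    Finset.subset_insert _ _, isNClique_window_zero, by
      rintro (i | i) hi
      · rw [kCaterpillar_adj_inr_inl, mem_window, InWindow]
        simp
      · simp [mem_window, InWindow, kCaterpillar_not_adj_inr_inr]⟩
  have hp : insert (.inr (.inl 0)) (insert (.inr (.inr false)) (window k t 0)) = part k t 0 := by
    ext (i | a | b)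
    · simp only [Finset.mem_insert, mem_window, mem_part, InWindow, InPart, reduceCtorEq, false_or]
      omega
    · simp only [Finset.mem_insert, mem_window, mem_part, InWindow, InPart, reduceCtorEq,
        Sum.inr.injEq, Sum.inl.injEq, or_false, Fin.ext_iff, Fin.val_zero]
      omega
    · simp [mem_window, mem_part, InWindow, InPart]
  rw [hp] at h2
  convert h2 using 1
  ring

/-- One `State.extend` along the stem, then one `State.leaf`. The old window ends with degree 3, and
the new one reaches degree 2, which `State` permits for the current clique. -/
theorem state_part_succ (hk : 1 ≤ k) {j z y r ρ : ℕ} (hj : j < t)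
    (hs : State k (kCaterpillar k t) (part k t j) (window k t j) 2 z y r ρ) :
    State k (kCaterpillar k t) (part k t (j + 1)) (window k t (j + 1)) 2 (2 * (z + 1))
      (y + z + k + (z + 1) + k) (2 * (r + z) + (z + 1)) (ρ + r + z + (r + z) + (z + 1)) := by
  have h1 := hs.extend (v := .inl ⟨k + j, by omega⟩) (x := .inl ⟨j, by omega⟩) ⟨by
      simp [mem_part, InPart], by
      rintro (i | i) hi
      · simp only [mem_window, mem_part, InWindow, InPart] at hi ⊢
        omega
      · exact absurd hi (by simp [mem_window, InWindow]), (mem_Cl.1 hs.mem).2, by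
      rintro (i | a | b) hi
      · simp only [mem_part, InPart] at hi
        simp only [kCaterpillar_adj_inl_inl, mem_window, InWindow]
        omega
      · simp only [mem_part, InPart] at hi
        simp only [mem_window, InWindow, iff_false]
        exact kCaterpillar_not_adj_inl_inr_inl (by simp only; omega)
      · simp only [mem_part, InPart] at hi
        subst hi
        simp only [mem_window, InWindow, iff_false]
        exact kCaterpillar_not_adj_inl_inr_false (by simp only; omega)⟩
    (by norm_num) (by simp only [mem_window, InWindow]; omega)
  have hw : insert (.inl ⟨k + j, by omega⟩) ((window k t j).erase (.inl ⟨j, by omega⟩)) =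
      window k t (j + 1) := by
    ext (i | i)
    · simp only [Finset.mem_insert, Finset.mem_erase, mem_window, InWindow, Sum.inl.injEq, ne_eq,
        Fin.ext_iff]
      omega
    · simp [mem_window, InWindow]
  rw [hw] at h1
  have h2 := h1.leaf (v := .inr (.inl ⟨j + 1, by omega⟩)) ⟨by
      simp [mem_part, InPart], (mem_Cl.1 h1.mem).1, (mem_Cl.1 h1.mem).2, by
      rintro (i | i) hi
      · simp only [kCaterpillar_adj_inr_inl, mem_window, InWindow]
      · simp [mem_window, InWindow, kCaterpillar_not_adj_inr_inr]⟩
  have hp : insert (.inr (.inl ⟨j + 1, by omega⟩))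
      (insert (.inl ⟨k + j, by omega⟩) (part k t j)) = part k t (j + 1) := by
    ext (i | a | b)
    · simp only [Finset.mem_insert, mem_part, InPart, Sum.inl.injEq, reduceCtorEq, false_or,
        Fin.ext_iff]
      omega
    · simp only [Finset.mem_insert, mem_part, InPart, Sum.inr.injEq, Sum.inl.injEq, reduceCtorEq,
        false_or, Fin.ext_iff]
      omega
    · simp [mem_part, InPart]
  rwa [hp] at h2

/-- Closed forms of the recursion, arranged without subtraction in `ℕ`. -/
theorem exists_state_part (hk : 1 ≤ k) {j : ℕ} (hj : j ≤ t) : ∃ z y r ρ : ℕ,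
    State k (kCaterpillar k t) (part k t j) (window k t j) 2 z y r ρ ∧
      z + 2 = 6 * 2 ^ j ∧ y + 8 + 3 * j = 2 * k + 12 * 2 ^ j + 2 * k * j ∧
      r + 2 ^ j = 9 * j * 2 ^ j + 5 ∧ ρ + 20 * 2 ^ j = 18 * j * 2 ^ j + 24 + 5 * j := by
  induction j with
  | zero => exact ⟨_, _, _, _, state_part_zero, by norm_num, by ring, by norm_num, by norm_num⟩
  | succ j ih =>
    obtain ⟨z, y, r, ρ, hs, hz, hy, hr, hρ⟩ := ih (by omega)
    refine ⟨_, _, _, _, state_part_succ hk (by omega) hs, ?_, ?_, ?_, ?_⟩ <;> rw [pow_succ] <;>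
      linarith

theorem exists_state_kCaterpillar (hk : 1 ≤ k) (t : ℕ) : ∃ z y r ρ : ℕ,
    State k (kCaterpillar k t) Finset.univ (window k t t) 3 z y r ρ ∧
      y + 10 + 3 * t = 3 * k + 18 * 2 ^ t + 2 * k * t ∧
      ρ + 15 * 2 ^ t = 27 * t * 2 ^ t + 27 + 5 * t := by
  obtain ⟨z, y, r, ρ, hs, hz, hy, hr, hρ⟩ := exists_state_part hk (le_refl t)
  have h1 := hs.leaf (v := .inr (.inr true)) ⟨by simp [mem_part, InPart], (mem_Cl.1 hs.mem).1,
    (mem_Cl.1 hs.mem).2, by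
      rintro (i | i) hi
      · simp only [kCaterpillar_adj_inr_true, mem_window, InWindow]
        omega
      · simp [mem_window, InWindow, kCaterpillar_not_adj_inr_inr]⟩
  have hp : insert (.inr (.inr true)) (part k t t) = Finset.univ := by
    ext (i | a | b)
    · simp [mem_part, InPart]
    · simp only [Finset.mem_insert, mem_part, InPart, Finset.mem_univ, iff_true]
      right; omega
    · cases b <;> simp [mem_part, InPart]
  rw [hp] at h1
  exact ⟨_, _, _, _, h1, by linarith, by linarith⟩

theorem isKTree_kCaterpillar (hk : 1 ≤ k) (t : ℕ) : IsKTree k (kCaterpillar k t) := by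
  obtain ⟨_, _, _, _, hs, -⟩ := exists_state_kCaterpillar hk t
  exact isKTree_iff_KT_univ.2 hs.kt

theorem noCliqueOfDegreeTwo_kCaterpillar (hk : 1 ≤ k) (t : ℕ) :
    NoCliqueOfDegreeTwo k (kCaterpillar k t) := by
  obtain ⟨_, _, _, _, hs, -⟩ := exists_state_kCaterpillar hk t
  exact hs.noCliqueOfDegreeTwo (by norm_num)

theorem tendsto_kCaterpillar (hk : 1 ≤ k) :
    Tendsto (fun t : ℕ =>
      (3 * ((2 * t + k + 3 : ℕ) : ℝ) + k - 3) / 4 - globalMean k (kCaterpillar k t))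
      atTop (𝓝 (7 / 3)) := by
  have h0 := tendsto_natPow_div_two_pow 0
  have h1 := tendsto_natPow_div_two_pow 1
  have h2 := tendsto_natPow_div_two_pow 2
  have hnum : Tendsto (fun t : ℕ => 42 + (((3 * k - 10) * 3 / 2 - 27) * ((t : ℝ) ^ 0 / 2 ^ t) +
      ((3 * k - 10) * 3 / 2 + (2 * k - 3) * 3 / 2 - 5) * ((t : ℝ) ^ 1 / 2 ^ t) +
      (2 * k - 3) * 3 / 2 * ((t : ℝ) ^ 2 / 2 ^ t))) atTop (𝓝 42) := by
    simpa using ((((h0.const_mul ((3 * (k : ℝ) - 10) * 3 / 2 - 27)).add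
      (h1.const_mul ((3 * (k : ℝ) - 10) * 3 / 2 + (2 * k - 3) * 3 / 2 - 5))).add
      (h2.const_mul ((2 * (k : ℝ) - 3) * 3 / 2))).const_add 42)
  have hden : Tendsto (fun t : ℕ => 18 + ((3 * k - 10) * ((t : ℝ) ^ 0 / 2 ^ t) +
      (2 * k - 3) * ((t : ℝ) ^ 1 / 2 ^ t))) atTop (𝓝 18) := by
    simpa using (((h0.const_mul (3 * (k : ℝ) - 10)).add
      (h1.const_mul (2 * (k : ℝ) - 3))).const_add 18)
  have h := hnum.div hden (by norm_num)
  rw [show (42 : ℝ) / 18 = 7 / 3 by norm_num] at h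
  refine h.congr fun t => ?_
  obtain ⟨z, y, r, ρ, hs, hy, hρ⟩ := exists_state_kCaterpillar hk t
  have hy' : (y : ℝ) = 3 * k + 18 * 2 ^ t + 2 * k * t - 10 - 3 * t := by
    have : ((y + 10 + 3 * t : ℕ) : ℝ) = ((3 * k + 18 * 2 ^ t + 2 * k * t : ℕ) : ℝ) := by rw [hy]
    push_cast at this
    linarith
  have hρ' : (ρ : ℝ) = 27 * t * 2 ^ t + 27 + 5 * t - 15 * 2 ^ t := by
    have : ((ρ + 15 * 2 ^ t : ℕ) : ℝ) = ((27 * t * 2 ^ t + 27 + 5 * t : ℕ) : ℝ) := by rw [hρ]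
    push_cast at this
    linarith
  have hy0 : (y : ℝ) ≠ 0 := by
    rw [← hs.card_all]
    exact_mod_cast hs.kt.card_Fam_pos.ne'
  have hp : (2 : ℝ) ^ t ≠ 0 := by positivity
  have hd : 18 + ((3 * (k : ℝ) - 10) * ((t : ℝ) ^ 0 / 2 ^ t) +
      (2 * k - 3) * ((t : ℝ) ^ 1 / 2 ^ t)) = y / 2 ^ t := by
    rw [hy']
    field_simp
    ring
  rw [Pi.div_apply, hs.globalMean, hd, div_eq_iff (by positivity)]
  -- With n = 2t + k + 3, the upper bound minus k equals 3(t + 1)/2. In the numerator the t·2^t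
  -- terms cancel, leaving (27 + 15)·2^t against y ~ 18·2^t, whence 42/18 = 7/3.
  have : ((3 * ((2 * t + k + 3 : ℕ) : ℝ) + k - 3) / 4 - (k + ρ / y)) * (y / 2 ^ t) =
      (3 * (t + 1) / 2 * y - ρ) / 2 ^ t := by
    push_cast
    field_simp
    ring
  rw [this, hy', hρ']
  field_simp
  ring

theorem exists_three_quarters_lt (hk : 13 ≤ k) (n₀ : ℕ) : ∃ n : ℕ, n₀ ≤ n ∧
    ∃ T : SimpleGraph (Fin n), IsKTree k T ∧ NoCliqueOfDegreeTwo k T ∧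
      3 * (n : ℝ) / 4 < globalMean k T := by
  have hk1 : 1 ≤ k := by omega
  -- A gap below 5/2 suffices, since (k - 3)/4 ≥ 5/2 for k ≥ 13.
  obtain ⟨t, hlt, ht⟩ := (((tendsto_kCaterpillar hk1).eventually_lt_const
    (show (7 / 3 : ℝ) < 5 / 2 by norm_num)).and (eventually_ge_atTop n₀)).exists
  let e : Fin (k + t) ⊕ (Fin (t + 1) ⊕ Bool) ≃ Fin (2 * t + k + 3) :=
    Fintype.equivFinOfCardEq (by simp; ring)
  have he := SimpleGraph.Iso.map e (kCaterpillar k t)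
  have hT := isKTree_iso (isKTree_kCaterpillar hk1 t) he
  refine ⟨2 * t + k + 3, by omega, _, hT,
    noCliqueOfDegreeTwo_iso he (noCliqueOfDegreeTwo_kCaterpillar hk1 t), ?_⟩
  rw [← globalMean_iso he (isKTree_iff_KT_univ.1 (isKTree_kCaterpillar hk1 t))
    (isKTree_iff_KT_univ.1 hT)]
  have : (13 : ℝ) ≤ k := by exact_mod_cast hk
  linarith

end Caterpillar

end SubKTree

theorem mainTheorem3 :
    (∀ k : ℕ, 1 ≤ k →
      -- the lower bound
      (∃ ε : ℕ → ℝ, Tendsto ε atTop (𝓝 0) ∧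
        ∀ (V : Type u) [Fintype V] (T : SimpleGraph V),
          IsKTree k T → NoCliqueOfDegreeTwo k T →
          ((Fintype.card V : ℝ) + k) / 2 - ε (Fintype.card V) < globalMean k T) ∧
      -- the upper bound
      (∀ (V : Type u) [Fintype V] (T : SimpleGraph V),
          IsKTree k T → NoCliqueOfDegreeTwo k T → k + 2 ≤ Fintype.card V →
          globalMean k T < (3 * (Fintype.card V : ℝ) + k - 3) / 4) ∧
      -- asymptotic sharpness of the lower bound
      ((∀ n : ℕ, k + 3 ≤ n → IsKTree k (kStar k n) ∧ NoCliqueOfDegreeTwo k (kStar k n)) ∧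
        Tendsto (fun n : ℕ => ((n : ℝ) + k) / 2 - globalMean k (kStar k n)) atTop (𝓝 0)) ∧
      -- asymptotic sharpness of the upper bound
      ((∀ t : ℕ, IsKTree k (kCaterpillar k t) ∧ NoCliqueOfDegreeTwo k (kCaterpillar k t)) ∧
        Tendsto (fun t : ℕ =>
          (3 * ((2 * t + k + 3 : ℕ) : ℝ) + k - 3) / 4 - globalMean k (kCaterpillar k t))
          atTop (𝓝 (7 / 3))) ∧
      -- for large order the `k`-star is the unique extremal graph for the lower bound
      (∃ n₀ : ℕ, ∀ n : ℕ, n₀ ≤ n →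
        IsKTree k (kStar k n) ∧ NoCliqueOfDegreeTwo k (kStar k n) ∧
        ∀ (V : Type u) [Fintype V] (T : SimpleGraph V),
          Fintype.card V = n → IsKTree k T → NoCliqueOfDegreeTwo k T →
          globalMean k (kStar k n) ≤ globalMean k T ∧
          (globalMean k T = globalMean k (kStar k n) ↔ Nonempty (T ≃g kStar k n)))) ∧
    -- for large `k`, `3 n / 4` is not an upper bound (even for large order)
    (∃ K : ℕ, ∀ k : ℕ, K ≤ k → ∀ n₀ : ℕ, ∃ n : ℕ, n₀ ≤ n ∧
      ∃ T : SimpleGraph (Fin n), IsKTree k T ∧ NoCliqueOfDegreeTwo k T ∧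
        3 * (n : ℝ) / 4 < globalMean k T) := by
  refine ⟨fun k hk => ⟨SubKTree.lower_bound k, fun V _ T hT hd hn => SubKTree.upper_bound hk hT hd hn,
    ⟨fun n hn => ⟨SubKTree.isKTree_kStar (by omega), SubKTree.noCliqueOfDegreeTwo_kStar hn⟩,
      SubKTree.tendsto_kStar k⟩,
    ⟨fun t => ⟨SubKTree.isKTree_kCaterpillar hk t, SubKTree.noCliqueOfDegreeTwo_kCaterpillar hk t⟩,
      SubKTree.tendsto_kCaterpillar hk⟩, ?_⟩, 13, fun k hk => SubKTree.exists_three_quarters_lt hk⟩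
  obtain ⟨n₀, h₀, h⟩ := SubKTree.extremal_kStar.{u} k
  exact ⟨n₀, fun n hn => ⟨SubKTree.isKTree_kStar (by omega),
    SubKTree.noCliqueOfDegreeTwo_kStar (by omega), h n hn⟩⟩
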